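/- Let $K$ be a field. A $K$-variety is a separated scheme of finite type over $K$ (not assumed reduced or irreducible), and $V(K)$ is the set of $K$-points of a $K$-variety $V$. A system of topologies over $K$ is a choice of a topology on $V(K)$ for every $K$-variety $V$ such that, for every morphism $f : V \to W$ of $K$-varieties, the induced map $V(K) \to W(K)$ is continuous, is an open embedding if $f$ is an open immersion, and is a closed embedding if $f$ is a closed immersion. The étale-open system of topologies over $K$ assigns to each $K$-variety $V$ the topology on $V(K)$ with basis the sets $f(X(K))$, where $f : X \to V$ ranges over étale morphisms of $K$-varieties. A field topology on $K$ is a Hausdorff topology for which addition, multiplication, and inversion on $K^\times$ are continuous. For a field topology $\tau$ on $K$, the system of topologies induced by $\tau$ is the system of topologies such that for every $n$ the topology on $\mathbb{A}^n(K) = K^n$ is the product of $n$ copies of $\tau$. A set $B \subseteq K$ is $\tau$-bounded if for every open neighborhood $U$ of $0$ there is a non-zero $a \in K$ with $aB \subseteq U$. A V-topology is a non-discrete field topology $\tau$ such that $(K \setminus U)^{-1}$ is $\tau$-bounded for every neighborhood $U$ of $0$. A topology $\tau$ on $K$ is t-Henselian if it is a V-topology and for every $n \ge 0$ there is a $\tau$-open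 neighborhood $U$ of $0$ such that for all $\alpha_0, \ldots, \alpha_n \in U$ the polynomial $x^{n+2} + x^{n+1} + \alpha_n x^n + \cdots + \alpha_1 x + \alpha_0$ has a root in $K$. **Theorem.** 1. If $\tau$ is a t-Henselian topology on $K$ and $K$ is not separably closed, then the étale-open system of topologies over $K$ is (a system of topologies and is) induced by $\tau$. (In particular $\tau$ is the only t-Henselian topology on $K$.) 2. If $K$ is real closed, then the order topology on $K$ is t-Henselian, and the étale-open system of topologies over $K$ is induced by it. 3. If $v$ is a non-trivial Henselian valuation on $K$ (of arbitrary rank), then the valuation topology on $K$ is t-Henselian, and if moreover $K$ is not separably closed, then the étale-open system of topologies over $K$ is induced by it. -/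

import Mathlib

open CategoryTheory AlgebraicGeometry Topology

universe u v

/-! ### Varieties and their rational points -/

/-- A `K`-variety: a separated scheme of finite type over `K`, not assumed reduced or irreducible.
(Finite type is locally of finite type together with quasi-compact.) A morphism of `K`-varieties
`V → W` is a morphism of `K`-schemes, that is, an element of `V.toOver ⟶ W.toOver`. -/
structure Variety (K : Type u) [Field K] where
  toOver : Over (Spec (CommRingCat.of K))
  locallyOfFiniteType : LocallyOfFiniteType toOver.hom
  quasiCompact : QuasiCompact toOver.hom
  isSeparated : IsSeparated toOver.hom

namespace Variety

variable {K : Type u} [Field K]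

/-- The set `V(K)` of `K`-points: morphisms of `K`-schemes `Spec K → V`. -/
abbrev Points (V : Variety K) : Type u :=
  Over.mk (𝟙 (Spec (CommRingCat.of K))) ⟶ V.toOver

/-- The map `V(K) → W(K)` induced by a morphism `V → W`. -/
noncomputable def mapPoints {V W : Variety K} (f : V.toOver ⟶ W.toOver) (p : V.Points) : W.Points :=
  p ≫ f

variable (K) in
/-- Affine `n`-space `Spec K[x₁, …, xₙ]` as a `K`-scheme. -/
noncomputable def affineSpaceOver (n : ℕ) : Over (Spec (CommRingCat.of K)) :=
  Over.mk (Spec.map (CommRingCat.ofHom (algebraMap K (MvPolynomial (Fin n) K))))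

variable (K) in
/-- Affine `n`-space over `K` as a `K`-variety. -/
noncomputable def affineSpace (n : ℕ) : Variety K where
  toOver := affineSpaceOver K n
  locallyOfFiniteType := by
    refine (HasRingHomProperty.Spec_iff (P := @LocallyOfFiniteType)).mpr ?_
    exact RingHom.finiteType_algebraMap.mpr inferInstance
  quasiCompact := by dsimp [affineSpaceOver]; infer_instance
  isSeparated := by dsimp [affineSpaceOver]; infer_instance

/-- The ring homomorphism `K[x₁, …, xₙ] → K` corresponding to a `K`-point of affine `n`-space. -/
noncomputable def affineSpacePointHom {n : ℕ} (p : (affineSpace K n).Points) :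
    MvPolynomial (Fin n) K →+* K :=
  (Spec.preimage (R := CommRingCat.of (MvPolynomial (Fin n) K)) (S := CommRingCat.of K)
    p.left).hom

/-- The `K`-point of affine `n`-space corresponding to evaluation of polynomials at `a`. -/
noncomputable def affineSpacePointOf {n : ℕ} (a : Fin n → K) : (affineSpace K n).Points :=
  Over.homMk (U := Over.mk (𝟙 (Spec (CommRingCat.of K)))) (V := affineSpaceOver K n)
    (Spec.map (CommRingCat.ofHom (MvPolynomial.eval a))) (by
      dsimp [affineSpaceOver]
      rw [← Spec.map_comp, ← CommRingCat.ofHom_comp, ← Spec.map_id]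
      congr 2
      ext x
      simp)

theorem specMap_affineSpacePointHom {n : ℕ} (p : (affineSpace K n).Points) :
    Spec.map (CommRingCat.ofHom (affineSpacePointHom p)) = p.left :=
  Spec.map_preimage (R := CommRingCat.of (MvPolynomial (Fin n) K)) (S := CommRingCat.of K) p.left

theorem affineSpacePointHom_C {n : ℕ} (p : (affineSpace K n).Points) (c : K) :
    affineSpacePointHom p (MvPolynomial.C c) = c := by
  have hw : p.left ≫ Spec.map (CommRingCat.ofHom (algebraMap K (MvPolynomial (Fin n) K))) =
      𝟙 (Spec (CommRingCat.of K)) := Over.w p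
  have h : Spec.map (CommRingCat.ofHom
      ((affineSpacePointHom p).comp (algebraMap K (MvPolynomial (Fin n) K)))) =
      Spec.map (𝟙 (CommRingCat.of K)) := by
    rw [CommRingCat.ofHom_comp, Spec.map_comp, Spec.map_id, ← hw]
    exact congrArg (· ≫ _) (specMap_affineSpacePointHom p)
  exact congrArg (fun ψ : CommRingCat.of K ⟶ CommRingCat.of K => ψ.hom c) (Spec.map_injective h)

theorem affineSpacePointHom_pointOf {n : ℕ} (a : Fin n → K) :
    affineSpacePointHom (affineSpacePointOf a) = MvPolynomial.eval a := by
  have h : Spec.map (CommRingCat.ofHom (affineSpacePointHom (affineSpacePointOf a))) =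
      Spec.map (CommRingCat.ofHom (MvPolynomial.eval a)) :=
    specMap_affineSpacePointHom (affineSpacePointOf a)
  exact congrArg CommRingCat.Hom.hom (Spec.map_injective h)

theorem affineSpacePointHom_injective {n : ℕ} :
    Function.Injective (affineSpacePointHom (K := K) (n := n)) := by
  intro p q h
  apply Over.OverMorphism.ext
  exact (specMap_affineSpacePointHom p).symm.trans
    ((congrArg (fun ψ => Spec.map (CommRingCat.ofHom ψ)) h).trans (specMap_affineSpacePointHom q))

variable (K) in
/-- The identification of `𝔸ⁿ(K)` with `Kⁿ`: the `K`-point `p` is sent to the images of the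
coordinates `xᵢ` under the ring homomorphism `K[x₁, …, xₙ] → K` corresponding to `p`. -/
noncomputable def affineSpacePoints (n : ℕ) : (affineSpace K n).Points ≃ (Fin n → K) where
  toFun p i := affineSpacePointHom p (MvPolynomial.X i)
  invFun a := affineSpacePointOf a
  left_inv p := by
    apply affineSpacePointHom_injective
    rw [affineSpacePointHom_pointOf]
    refine MvPolynomial.ringHom_ext (fun c => ?_) (fun i => ?_)
    · rw [affineSpacePointHom_C, MvPolynomial.eval_C]
    · rw [MvPolynomial.eval_X]
  right_inv a := by
    funext i
    change affineSpacePointHom (affineSpacePointOf a) (MvPolynomial.X i) = a i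
    rw [affineSpacePointHom_pointOf, MvPolynomial.eval_X]

end Variety

/-! ### Systems of topologies -/

/-- A choice of a topology on `V(K)` for every `K`-variety `V`. -/
abbrev TopologyFamily (K : Type u) [Field K] : Type (u + 1) :=
  ∀ V : Variety K, TopologicalSpace V.Points

namespace TopologyFamily

variable {K : Type u} [Field K]

/-- A family of topologies on the sets `V(K)` is a system of topologies if morphisms induce
continuous maps, open immersions induce open embeddings and closed immersions induce closed
embeddings. -/
structure IsSystemOfTopologies (T : TopologyFamily K) : Prop where
  continuous : ∀ {V W : Variety K} (f : V.toOver ⟶ W.toOver),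
    @Continuous _ _ (T V) (T W) (Variety.mapPoints f)
  isOpenEmbedding : ∀ {V W : Variety K} (f : V.toOver ⟶ W.toOver), IsOpenImmersion f.left →
    @IsOpenEmbedding _ _ (T V) (T W) (Variety.mapPoints f)
  isClosedEmbedding : ∀ {V W : Variety K} (f : V.toOver ⟶ W.toOver), IsClosedImmersion f.left →
    @IsClosedEmbedding _ _ (T V) (T W) (Variety.mapPoints f)

/-- The family `T` is the system of topologies induced by the topology `τ` on `K`: it is a system
of topologies, and for every `n` the `T`-topology on `𝔸ⁿ(K) = Kⁿ` is the product of `n` copies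
of `τ` (in particular, the `T`-topology on `𝔸¹(K) = K` is `τ`). For a Hausdorff field topology `τ`
there is exactly one such family. -/
structure IsInducedBy (T : TopologyFamily K) (τ : TopologicalSpace K) : Prop where
  isSystemOfTopologies : T.IsSystemOfTopologies
  affineSpace_eq : ∀ n : ℕ, T (Variety.affineSpace K n) =
    TopologicalSpace.induced (Variety.affineSpacePoints K n)
      (@Pi.topologicalSpace (Fin n) (fun _ => K) (fun _ => τ))

end TopologyFamily

/-! ### The étale-open topology -/

/-- The étale images in `V(K)`: the sets `f(X(K))` for `f : X → V` an étale morphism of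
`K`-varieties. -/
def etaleImages {K : Type u} [Field K] (V : Variety K) : Set (Set V.Points) :=
  {S | ∃ (X : Variety K) (f : X.toOver ⟶ V.toOver), Etale f.left ∧
    S = Set.range (Variety.mapPoints f)}

/-- The étale-open system of topologies over `K`: the topology on `V(K)` is generated by the étale
images in `V(K)`. These form a basis of it, see `isTopologicalBasis_etaleImages`. -/
@[reducible] def etaleOpen (K : Type u) [Field K] : TopologyFamily K :=
  fun V => TopologicalSpace.generateFrom (etaleImages V)

theorem isTopologicalBasis_etaleImages {K : Type u} [Field K] (V : Variety K) :
    @TopologicalSpace.IsTopologicalBasis _ (etaleOpen K V) (etaleImages V) := by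
  let := etaleOpen K V
  refine ⟨?_, ?_, rfl⟩
  · rintro _ ⟨X, f, hf, rfl⟩ _ ⟨Y, g, hg, rfl⟩ x hx
    refine ⟨_, ?_, hx, subset_rfl⟩
    have := X.locallyOfFiniteType
    have := X.quasiCompact
    have := X.isSeparated
    have := Y.locallyOfFiniteType
    have := Y.quasiCompact
    have := Y.isSeparated
    have := V.isSeparated
    have := V.quasiCompact
    have hfX : f.left ≫ V.toOver.hom = X.toOver.hom := Over.w f
    have hgY : g.left ≫ V.toOver.hom = Y.toOver.hom := Over.w g
    have : IsSeparated g.left := by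
      have : IsSeparated (g.left ≫ V.toOver.hom) := by rw [hgY]; infer_instance
      exact IsSeparated.of_comp g.left V.toOver.hom
    have : QuasiCompact g.left := by
      have : QuasiCompact (g.left ≫ V.toOver.hom) := by rw [hgY]; infer_instance
      exact QuasiCompact.of_comp g.left V.toOver.hom
    let P : Variety K :=
      { toOver := Over.mk (Limits.pullback.fst f.left g.left ≫ X.toOver.hom)
        locallyOfFiniteType := by dsimp; infer_instance
        quasiCompact := by dsimp; infer_instance
        isSeparated := by dsimp; infer_instance }
    let q : P.toOver ⟶ X.toOver := Over.homMk (Limits.pullback.fst f.left g.left)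
    let r : P.toOver ⟶ Y.toOver := Over.homMk (Limits.pullback.snd f.left g.left) (by
      dsimp [P]
      rw [← hgY, ← hfX, Limits.pullback.condition_assoc])
    have hqr : q ≫ f = r ≫ g := by
      ext1
      exact Limits.pullback.condition
    refine ⟨P, q ≫ f, ?_, ?_⟩
    · change Etale (Limits.pullback.fst f.left g.left ≫ f.left)
      infer_instance
    · ext y
      constructor
      · rintro ⟨⟨a, rfl⟩, b, hb⟩
        have hb' : b ≫ g = a ≫ f := hb
        refine ⟨Over.homMk (Limits.pullback.lift a.left b.left ?_) ?_, ?_⟩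
        · rw [← Over.comp_left, ← Over.comp_left, hb']
        · have ha : a.left ≫ X.toOver.hom = 𝟙 _ := Over.w a
          change Limits.pullback.lift a.left b.left _ ≫ Limits.pullback.fst f.left g.left ≫
            X.toOver.hom = 𝟙 _
          rw [Limits.pullback.lift_fst_assoc, ha]
        · change _ ≫ _ = a ≫ f
          ext1
          change Limits.pullback.lift a.left b.left _ ≫ Limits.pullback.fst f.left g.left ≫
            f.left = a.left ≫ f.left
          rw [Limits.pullback.lift_fst_assoc]
      · rintro ⟨c, rfl⟩
        refine ⟨⟨c ≫ q, ?_⟩, ⟨c ≫ r, ?_⟩⟩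
        · simp [Variety.mapPoints]
        · simp [Variety.mapPoints, hqr]
  · refine Set.eq_univ_of_univ_subset (Set.subset_sUnion_of_mem ⟨V, 𝟙 _, ?_, ?_⟩)
    · rw [Over.id_left]; infer_instance
    · ext y
      simp [Variety.mapPoints]

/-! ### t-Henselian field topologies -/

section FieldTopologies

variable (K : Type u) [Field K] [TopologicalSpace K]

/-- A field topology: a Hausdorff topology for which addition, multiplication and inversion on
`K \ {0}` are continuous. -/
structure IsFieldTopology : Prop where
  isTopologicalDivisionRing : IsTopologicalDivisionRing K
  t2Space : T2Space K

variable {K} in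
/-- `B ⊆ K` is bounded if every open neighbourhood of `0` contains `a · B` for some `a ≠ 0`. -/
def IsFieldBounded (B : Set K) : Prop :=
  ∀ U : Set K, IsOpen U → (0 : K) ∈ U → ∃ a : K, a ≠ 0 ∧ ∀ b ∈ B, a * b ∈ U

/-- A V-topology: a non-discrete field topology such that `(K \ U)⁻¹` is bounded for every
neighbourhood `U` of `0`. -/
structure IsVTopology : Prop where
  isFieldTopology : IsFieldTopology K
  not_discrete : ¬ DiscreteTopology K
  bounded_inv : ∀ U ∈ 𝓝 (0 : K), IsFieldBounded ((fun x : K => x⁻¹) '' Uᶜ)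

/-- A t-Henselian topology: a V-topology such that for every `n` there is an open neighbourhood `U`
of `0` such that `x ^ (n + 2) + x ^ (n + 1) + αₙ x ^ n + ⋯ + α₁ x + α₀` has a root in `K` whenever
`α₀, …, αₙ ∈ U`. -/
structure IsTHenselian : Prop where
  isVTopology : IsVTopology K
  exists_root : ∀ n : ℕ, ∃ U : Set K, IsOpen U ∧ (0 : K) ∈ U ∧
    ∀ α : Fin (n + 1) → K, (∀ i, α i ∈ U) →
      ∃ x : K, x ^ (n + 2) + x ^ (n + 1) + ∑ i : Fin (n + 1), α i * x ^ (i : ℕ) = 0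

end FieldTopologies

-- On an affine variety `Spec A` the étale-open topology is shown to equal the topology of pointwise
-- convergence on the `K`-algebra homomorphisms `A → K`. There are two halves.
--
-- Étale images are open for pointwise convergence (`IsTHenselian.range_comp_mem_nhds`): an étale
-- algebra is locally standard étale, so a point above is a simple root of a monic polynomial, and
-- simple roots move continuously with the coefficients (`IsTHenselian.exists_tendsto_root`).
--
-- Conversely, étale images can be made small (`IsTHenselian.exists_etale_forall_apply_mem`). If `K`
-- is not separably closed, there is a monic separable `f` without roots. Its values stay away from
-- `0`, so `1 / f` is bounded on `K`, and `c / f` takes values in any prescribed neighbourhood of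
-- `0` for a suitable `c ≠ 0`. The étale cover defined by `a = φ a + c / f(y) - c / f(x₀)` then
-- confines `a` to a given neighbourhood of `φ a`.
--
-- Both halves use t-Henselianity in nonstandard form. In the ultrapower of `K` along an
-- ultrafilter, the bounded germs form a valuation ring whose maximal ideal is the ideal of
-- infinitesimals. The root axiom makes this ring Henselian, because lifting a simple root reduces
-- to polynomials `x ^ (n + 2) + x ^ (n + 1) + ⋯` with infinitesimal remaining coefficients.
--
-- Continuity and open embeddings hold for the étale-open topology over every field, by base change
-- and composition of étale maps. Closed immersions reduce to quotients `A → A ⧸ I`, where pointwise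
-- convergence makes the claim evident. For parts 2 and 3 it remains to verify t-Henselianity: over
-- a real closed field from the fact that irreducible polynomials have degree at most `2`, and for a
-- Henselian valuation by lifting the simple residue root `-1`.

universe w

/-! ### A root criterion for Henselian valuation rings -/

section HenselianCriterion

open Polynomial IsLocalRing

namespace ValuationSubring

variable {F : Type u} [Field F] (V : ValuationSubring F)

/-- A root in `F` of a monic polynomial over a valuation subring lies in the subring. -/
theorem exists_eq_of_aeval_eq_zero {f : V[X]} (hf : f.Monic) {z : F} (hz : aeval z f = 0) :
    ∃ r : V, f.IsRoot r ∧ (r : F) = z := by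
  obtain ⟨r, hr⟩ := IsIntegrallyClosed.isIntegral_iff.mp (⟨f, hf, hz⟩ : IsIntegral V z)
  refine ⟨r, ?_, hr⟩
  have h : algebraMap V F (f.eval r) = 0 := by
    rw [← hz, ← hr, aeval_algebraMap_apply]; rfl
  exact (FaithfulSMul.algebraMap_injective V F) (by simpa using h)

/-- If all polynomials `x ^ (n + 2) + x ^ (n + 1) + αₙ x ^ n + ⋯ + α₀` with non-units `αᵢ` have a
root, then every monic lift of `x ^ d * (x + 1)` has a root that reduces to `-1`. -/
theorem exists_root_residue_eq_neg_one
    (H : ∀ (n : ℕ) (α : Fin (n + 1) → V), (∀ i, α i ∈ maximalIdeal V) →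
      ∃ x : F, x ^ (n + 2) + x ^ (n + 1) + ∑ i : Fin (n + 1), (α i : F) * x ^ (i : ℕ) = 0)
    (d : ℕ) : ∀ f : V[X], f.Monic → f.map (residue V) = X ^ d * (X + 1) →
      ∃ r : V, f.IsRoot r ∧ residue V r = -1 := by
  have hdeg : ∀ (d : ℕ) (f : V[X]), f.Monic → f.map (residue V) = X ^ d * (X + 1) →
      f.natDegree = d + 1 := by
    intro d f hf h
    rw [← hf.natDegree_map (residue V), h]
    rw [← C_1, natDegree_mul (by simp) (X_add_C_ne_zero 1), natDegree_X_add_C, natDegree_X_pow]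
  induction d with
  | zero =>
    intro f hf h
    have h1 := hdeg 0 f hf h
    have hfe : f = X + C (f.coeff 0) := hf.eq_X_add_C h1
    refine ⟨-f.coeff 0, ?_, ?_⟩
    · rw [hfe]; simp
    · have := congrArg (fun p => p.coeff 0) h
      simp [coeff_map] at this
      simp [this]
  | succ d ih =>
    intro f hf h
    have h1 := hdeg _ f hf h
    have hcoeff : ∀ i, residue V (f.coeff i) =
        ((X ^ (d + 2) + X ^ (d + 1) : (ResidueField V)[X])).coeff i := by
      intro i
      rw [← coeff_map, h]; congr 1; ring
    have hu : IsUnit (f.coeff (d + 1)) := by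
      rw [← residue_ne_zero_iff_isUnit, hcoeff]
      simp [coeff_X_pow]
    obtain ⟨u, hu⟩ := hu
    have hm : ∀ i : Fin (d + 1), f.coeff i ∈ maximalIdeal V := by
      intro i
      rw [← residue_eq_zero_iff, hcoeff]
      have h2 : (i : ℕ) ≠ d + 2 := by omega
      have h3 : (i : ℕ) ≠ d + 1 := by omega
      simp [coeff_X_pow, h2, h3]
    -- `H` needs coefficient exactly `1` in degree `d + 1`, while here it is a unit `u`.
    -- Substituting `u * x` and dividing by `u ^ (d + 2)` normalises it.
    obtain ⟨x, hx⟩ := H d (fun i => f.coeff i * ↑(u⁻¹ ^ (d + 2 - (i : ℕ))))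
      (fun i => Ideal.mul_mem_right _ _ (hm i))
    have hu0 : ((u : V) : F) ≠ 0 := by
      intro h0
      exact u.ne_zero (Subtype.ext h0)
    have huinv : (((u⁻¹ : Vˣ) : V) : F) = ((u : V) : F)⁻¹ := by
      refine eq_inv_of_mul_eq_one_left ?_
      exact congrArg Subtype.val u.inv_mul
    obtain ⟨r, hr, hrx⟩ := V.exists_eq_of_aeval_eq_zero hf (z := (u : V) * x) (by
      rw [aeval_eq_sum_range, h1, Finset.sum_range_succ, Finset.sum_range_succ]
      have hlead : f.coeff (d + 2) = 1 := by rw [← h1]; exact hf.coeff_natDegree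
      rw [hlead, ← hu]
      have : ∀ i ∈ Finset.range (d + 1), f.coeff i • ((u : V) * x : F) ^ i =
          ((u : V) : F) ^ (d + 2) * (((f.coeff i * ↑(u⁻¹ ^ (d + 2 - i)) : V) : F) * x ^ i) := by
        intro i hi
        have hi' : i ≤ d + 2 := by simp at hi; omega
        rw [Units.val_pow_eq_pow_val]
        push_cast
        rw [huinv, Algebra.smul_def, mul_pow, inv_pow]
        have : ((u : V) : F) ^ (d + 2) = ((u : V) : F) ^ (d + 2 - i) * ((u : V) : F) ^ i := by
          rw [← pow_add]; congr 1; omega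
        rw [this]
        have h2 : ((u : V) : F) ^ (d + 2 - i) ≠ 0 := pow_ne_zero _ hu0
        field_simp
        exact mul_comm _ _
      rw [Finset.sum_congr rfl this, ← Finset.mul_sum, Algebra.smul_def, Algebra.smul_def]
      have h3 : ∑ i ∈ Finset.range (d + 1),
          (((f.coeff i * ↑(u⁻¹ ^ (d + 2 - i)) : V) : F) * x ^ i) =
          - (x ^ (d + 2) + x ^ (d + 1)) := by
        rw [← Fin.sum_univ_eq_sum_range
          (fun i => (((f.coeff i * ↑(u⁻¹ ^ (d + 2 - i)) : V) : F) * x ^ i))]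
        linear_combination hx
      rw [h3]
      have h4 : algebraMap V F (u : V) = ((u : V) : F) := rfl
      rw [h4, map_one]
      ring)
    have hres : residue V r ^ (d + 1) * (residue V r + 1) = 0 := by
      have := congrArg (fun p => p.eval (residue V r)) h
      simp only [eval_map_apply, hr.eq_zero, map_zero] at this
      simpa using this.symm
    rcases mul_eq_zero.mp hres with h0 | h0
    · have h0 : residue V r = 0 := by simpa using h0
      -- The root found reduces to `0` instead of `-1`; splitting it off leaves a lift of `X ^ d *
      -- (X + 1)`, to which induction applies.
      set g := f /ₘ (X - C r) with hg
      have hfg : (X - C r) * g = f := mul_divByMonic_eq_iff_isRoot.mpr hr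
      have hgm : g.Monic := (monic_X_sub_C r).of_mul_monic_left (hfg ▸ hf)
      obtain ⟨s, hs, hs'⟩ := ih g hgm (by
        have h2 : X * g.map (residue V) = X * (X ^ d * (X + 1)) := by
          have := congrArg (Polynomial.map (residue V)) hfg
          rw [h] at this
          simp [h0] at this
          rw [this]; ring
        exact mul_left_cancel₀ X_ne_zero h2)
      refine ⟨s, ?_, hs'⟩
      rw [← hfg, IsRoot, eval_mul, hs.eq_zero, mul_zero]
    · exact ⟨r, hr, by linear_combination h0⟩

/-- A valuation subring of `F` is Henselian as soon as all polynomials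
`x ^ (n + 2) + x ^ (n + 1) + αₙ x ^ n + ⋯ + α₀` with non-units `αᵢ` have a root in `F`. -/
theorem henselianLocalRing_of_exists_root
    (H : ∀ (n : ℕ) (α : Fin (n + 1) → V), (∀ i, α i ∈ maximalIdeal V) →
      ∃ x : F, x ^ (n + 2) + x ^ (n + 1) + ∑ i : Fin (n + 1), (α i : F) * x ^ (i : ℕ) = 0) :
    HenselianLocalRing V where
  is_henselian f hf a₀ h₀ h₁ := by
    set p := taylor a₀ f with hp
    have hpm : p.Monic := by
      rw [Monic, leadingCoeff_taylor, hf]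
    have hp0 : p.coeff 0 = f.eval a₀ := taylor_coeff_zero ..
    have hp1 : p.coeff 1 = f.derivative.eval a₀ := taylor_coeff_one ..
    obtain ⟨u, hu⟩ := h₁
    set c := p.coeff 0 with hc
    rw [← hp0] at h₀
    have hm : p.natDegree ≠ 0 := by
      intro h
      have : p = 1 := hpm.natDegree_eq_zero.mp h
      rw [hc, this] at h₀
      simp at h₀
    obtain ⟨d, hd⟩ := Nat.exists_eq_succ_of_ne_zero hm
    -- With `c = p(0)` and `u = p'(0)`, the substitution `x = c / (u * w)` gives `p(x) * w ^ (d + 1)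
    -- = c * h(w)`. Every `e k` with `k ≥ 2` contains a factor `c`, so `h` reduces to `X ^ d * (X +
    -- 1)`.
    let e : ℕ → V := fun k => p.coeff k * c ^ (k - 1) * ↑(u⁻¹ ^ k)
    let q : V[X] := ∑ k ∈ Finset.range d, C (e (k + 2)) * X ^ (d - 1 - k)
    let h : V[X] := X ^ (d + 1) + (X ^ d + q)
    have hq : q.degree < d := by
      refine (degree_sum_le _ _).trans_lt ?_
      refine (Finset.sup_lt_iff (WithBot.bot_lt_coe d)).mpr fun k hk => ?_
      refine (degree_C_mul_X_pow_le _ _).trans_lt ?_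
      have : k < d := by simpa using hk
      exact WithBot.coe_lt_coe.mpr (by omega : d - 1 - k < d)
    have hh : h.Monic := by
      refine monic_X_pow_add ?_
      refine (degree_add_le _ _).trans_lt (max_lt ?_ ?_)
      · rw [degree_X_pow]; exact_mod_cast Nat.lt_succ_self d
      · exact hq.trans (by exact_mod_cast Nat.lt_succ_self d)
    have hqm : q.map (residue V) = 0 := by
      simp only [q, Polynomial.map_sum]
      refine Finset.sum_eq_zero fun k _ => ?_
      have : residue V (e (k + 2)) = 0 := by
        have hc0 : residue V c = 0 := (residue_eq_zero_iff _).mpr h₀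
        simp [e, hc0]
      simp [this]
    obtain ⟨z, hz, hz1⟩ := V.exists_root_residue_eq_neg_one H d h hh (by
      simp [h, hqm]; ring)
    have hzu : IsUnit z := by
      rw [← residue_ne_zero_iff_isUnit, hz1]; simp
    obtain ⟨w, rfl⟩ := hzu
    set x : V := c * ↑u⁻¹ * ↑w⁻¹ with hx
    have hroot : p.eval x * (w : V) ^ (d + 1) = c * h.eval (w : V) := by
      have hterm : ∀ k ≤ d + 1, p.coeff k * x ^ k * (w : V) ^ (d + 1) =
          p.coeff k * c ^ k * ↑(u⁻¹ ^ k) * (w : V) ^ (d + 1 - k) := by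
        intro k hk
        have : (w : V) ^ (d + 1) = (w : V) ^ k * (w : V) ^ (d + 1 - k) := by
          rw [← pow_add]; congr 1; omega
        rw [this, hx, mul_pow, mul_pow, Units.val_pow_eq_pow_val]
        have h2 : ((w⁻¹ : Vˣ) : V) ^ k * (w : V) ^ k = 1 := by rw [← mul_pow]; simp
        linear_combination (p.coeff k * c ^ k * (↑u⁻¹ : V) ^ k * (w : V) ^ (d + 1 - k)) * h2
      rw [eval_eq_sum_range, hd, Finset.sum_mul]
      rw [Finset.sum_congr rfl (fun k hk => hterm k (by simp at hk; omega))]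
      rw [Finset.sum_range_succ', Finset.sum_range_succ']
      have h1 : p.coeff 1 * (↑u⁻¹ : V) = 1 := by rw [hp1, ← hu]; simp
      simp only [h, q, eval_add, eval_finsetSum, eval_mul, eval_C, eval_pow, eval_X, mul_add,
        Finset.mul_sum]
      have hs : ∀ k ∈ Finset.range d, p.coeff (k + 1 + 1) * c ^ (k + 1 + 1) *
          (↑(u⁻¹ ^ (k + 1 + 1)) : V) * (w : V) ^ (d + 1 - (k + 1 + 1)) =
          c * (e (k + 2) * (w : V) ^ (d - 1 - k)) := by
        intro k hk
        have : d + 1 - (k + 1 + 1) = d - 1 - k := by omega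
        rw [this]
        simp only [e, show k + 2 - 1 = k + 1 by omega]
        ring
      rw [Finset.sum_congr rfl hs]
      simp only [zero_add, pow_one, pow_zero, Nat.add_sub_cancel, Nat.sub_zero, Units.val_one]
      rw [← hc]
      linear_combination (c * (w : V) ^ d) * h1
    have hpx : p.eval x = 0 := by
      rw [hz.eq_zero, mul_zero] at hroot
      exact (mul_eq_zero.mp hroot).resolve_right (pow_ne_zero _ w.ne_zero)
    refine ⟨x + a₀, ?_, ?_⟩
    · rw [IsRoot, ← taylor_eval]; exact hpx
    · rw [add_sub_cancel_right]
      exact Ideal.mul_mem_right _ _ (Ideal.mul_mem_right _ _ h₀)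

end ValuationSubring

end HenselianCriterion

/-! ### The valuation ring of bounded germs along an ultrafilter -/

section BoundedGerms

open Polynomial IsLocalRing Filter

variable {K : Type u} [Field K] [TopologicalSpace K] {ι : Type w} (l : Ultrafilter ι)

namespace IsVTopology

theorem isTopologicalRing (hK : IsVTopology K) : IsTopologicalRing K :=
  hK.isFieldTopology.isTopologicalDivisionRing.toIsTopologicalRing

theorem not_tendsto_one (hK : IsVTopology K) : ¬ (1 : Germ (l : Filter ι) K).Tendsto (𝓝 0) := by
  have := hK.isFieldTopology.t2Space
  intro h
  have h' : Tendsto (fun _ : ι => (1 : K)) l (𝓝 0) := h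
  exact one_ne_zero (tendsto_nhds_unique tendsto_const_nhds h')

variable {l} in
theorem tendsto_add (hK : IsVTopology K) {x y : Germ (l : Filter ι) K}
    (hx : x.Tendsto (𝓝 0)) (hy : y.Tendsto (𝓝 0)) : (x + y).Tendsto (𝓝 0) := by
  have := hK.isTopologicalRing
  induction x, y using Germ.inductionOn₂ with
  | _ f g =>
    have := Filter.Tendsto.add (Germ.coe_tendsto.mp hx) (Germ.coe_tendsto.mp hy)
    rw [add_zero] at this
    exact Germ.coe_tendsto.mpr this

variable {l} in
/-- If a germ is not infinitesimal, then its inverse times an infinitesimal is infinitesimal. -/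
theorem tendsto_inv_mul (hK : IsVTopology K) {x y : Germ (l : Filter ι) K}
    (hx : ¬ x.Tendsto (𝓝 0)) (hy : y.Tendsto (𝓝 0)) : (x⁻¹ * y).Tendsto (𝓝 0) := by
  have := hK.isTopologicalRing
  induction x, y using Germ.inductionOn₂ with
  | _ f g =>
    rw [Germ.coe_tendsto] at hx hy
    rw [not_tendsto_iff_exists_frequently_notMem] at hx
    obtain ⟨U, hU, hfU⟩ := hx
    have hfU' : ∀ᶠ i in (l : Filter ι), f i ∉ U := Ultrafilter.frequently_iff_eventually.mp hfU
    have hB := hK.bounded_inv U hU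
    refine Germ.coe_tendsto.mpr ?_
    intro W hW
    have hmul : Tendsto (fun p : K × K => p.1 * p.2) (𝓝 0 ×ˢ 𝓝 0) (𝓝 0) := by
      have := (continuous_mul (M := K)).tendsto (0, 0)
      rwa [nhds_prod_eq, mul_zero] at this
    obtain ⟨W₁, hW₁, W₂, hW₂, hW'⟩ := Filter.mem_prod_iff.mp (hmul hW)
    obtain ⟨T, hTW, hT, hT0⟩ := mem_nhds_iff.mp hW₁
    -- `f` avoids `U` almost everywhere, so `f⁻¹` takes values in a bounded set. The scalar `a`
    -- makes `a * f⁻¹` small, and its inverse is absorbed by the infinitesimal `g`.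
    obtain ⟨a, ha, haB⟩ := hB T hT hT0
    have hga : Tendsto (fun i => a⁻¹ * g i) l (𝓝 0) := by
      simpa using hy.const_mul a⁻¹
    change ∀ᶠ i in (l : Filter ι), (f i)⁻¹ * g i ∈ W
    filter_upwards [hfU', hga hW₂] with i h1 h2
    have h3 := haB (f i)⁻¹ ⟨f i, h1, rfl⟩
    have h4 : (a * (f i)⁻¹, a⁻¹ * g i) ∈ W₁ ×ˢ W₂ := ⟨hTW h3, h2⟩
    have h5 := hW' h4
    have h6 : a * (f i)⁻¹ * (a⁻¹ * g i) = (f i)⁻¹ * g i := by field_simp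
    rw [← h6]
    exact h5

/-- The valuation ring of bounded germs, that is, of the multipliers of the infinitesimal germs. -/
noncomputable def boundedGerms (hK : IsVTopology K) : ValuationSubring (Germ (l : Filter ι) K) where
  carrier := {x | ∀ y : Germ (l : Filter ι) K, y.Tendsto (𝓝 0) → (x * y).Tendsto (𝓝 0)}
  mul_mem' {x y} hx hy z hz := by
    rw [mul_assoc]
    exact hx _ (hy _ hz)
  one_mem' z hz := by rwa [one_mul]
  add_mem' {x y} hx hy z hz := by
    rw [add_mul]
    exact hK.tendsto_add (hx _ hz) (hy _ hz)
  zero_mem' z _ := by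
    rw [zero_mul]
    exact (tendsto_const_nhds : Tendsto (fun _ : ι => (0 : K)) l (𝓝 0))
  neg_mem' {x} hx z hz := by
    have := hK.isTopologicalRing
    have h := hx z hz
    rw [neg_mul]
    generalize x * z = t at h ⊢
    induction t using Germ.inductionOn with
    | _ f =>
      refine Germ.coe_tendsto.mpr ?_
      have h' := (Germ.coe_tendsto.mp h).neg
      rw [neg_zero] at h'
      exact h'
  mem_or_inv_mem' x := by
    by_cases hx : x.Tendsto (𝓝 0)
    · left
      intro y hy
      -- A nonzero `x` and its inverse cannot both be infinitesimal, since their product is `1`.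
      by_cases hx0 : x⁻¹.Tendsto (𝓝 0)
      · by_cases h : x = 0
        · rw [h, zero_mul, ← h]; exact hx
        · exfalso
          have h1 : ¬ (1 : Germ (l : Filter ι) K).Tendsto (𝓝 0) := hK.not_tendsto_one l
          have := hK.isTopologicalRing
          apply h1
          rw [← mul_inv_cancel₀ h]
          clear h h1
          induction x using Germ.inductionOn with
          | _ f =>
            have := (Germ.coe_tendsto.mp hx).mul
              (show Tendsto (fun i => (f i)⁻¹) l (𝓝 0) from hx0)
            rw [mul_zero] at this
            exact this
      · simpa using hK.tendsto_inv_mul hx0 hy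
    · exact Or.inr fun y hy => hK.tendsto_inv_mul hx hy

theorem mem_boundedGerms_of_tendsto (hK : IsVTopology K) {x : Germ (l : Filter ι) K}
    (hx : x.Tendsto (𝓝 0)) : x ∈ hK.boundedGerms l := by
  rcases (hK.boundedGerms l).mem_or_inv_mem x with h | h
  · exact h
  · by_cases h0 : x = 0
    · rw [h0]; exact zero_mem _
    · have := h x hx
      rw [inv_mul_cancel₀ h0] at this
      exact absurd this (hK.not_tendsto_one l)

/-- The inverse of a germ that is not infinitesimal multiplies infinitesimals to infinitesimals,
hence is bounded; an infinitesimal unit would make `1` infinitesimal. Hensel's conditions modulo the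
maximal ideal thus become statements about limits. -/
theorem mem_maximalIdeal_boundedGerms (hK : IsVTopology K) (x : hK.boundedGerms l) :
    x ∈ maximalIdeal (hK.boundedGerms l) ↔ (x : Germ (l : Filter ι) K).Tendsto (𝓝 0) := by
  rw [mem_maximalIdeal, mem_nonunits_iff]
  constructor
  · intro h
    by_contra hx
    have hx' : (x : Germ (l : Filter ι) K)⁻¹ ∈ hK.boundedGerms l :=
      fun y hy => hK.tendsto_inv_mul hx hy
    have hx0 : (x : Germ (l : Filter ι) K) ≠ 0 := by
      rintro h0
      rw [h0] at hx
      exact hx (tendsto_const_nhds : Tendsto (fun _ : ι => (0 : K)) l (𝓝 0))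
    exact h (IsUnit.of_mul_eq_one ⟨_, hx'⟩ (Subtype.ext (mul_inv_cancel₀ hx0)))
  · rintro h ⟨u, rfl⟩
    have := ((u⁻¹ : (hK.boundedGerms l)ˣ) : hK.boundedGerms l).2 _ h
    rw [← MulMemClass.coe_mul, u.inv_mul] at this
    exact hK.not_tendsto_one l this

theorem const_mem_boundedGerms (hK : IsVTopology K) (c : K) :
    (↑c : Germ (l : Filter ι) K) ∈ hK.boundedGerms l := by
  have := hK.isTopologicalRing
  intro y hy
  induction y using Germ.inductionOn with
  | _ f =>
    have := (Germ.coe_tendsto.mp hy).const_mul c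
    rw [mul_zero] at this
    exact this

theorem mem_boundedGerms_of_tendsto_nhds (hK : IsVTopology K) {f : ι → K} {c : K}
    (hf : Tendsto f l (𝓝 c)) : (f : Germ (l : Filter ι) K) ∈ hK.boundedGerms l := by
  have := hK.isTopologicalRing
  have h : Tendsto (fun i => f i - c) l (𝓝 0) := by simpa using hf.sub_const c
  have h1 : (f : Germ (l : Filter ι) K) = ((fun i => f i - c : ι → K) : Germ (l : Filter ι) K) +
      (↑c : Germ (l : Filter ι) K) := by
    change _ = (((fun i => f i - c : ι → K) + fun _ => c : ι → K) : Germ (l : Filter ι) K)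
    congr 1
    ext i
    simp
  rw [h1]
  exact add_mem (hK.mem_boundedGerms_of_tendsto l h) (hK.const_mem_boundedGerms l c)

end IsVTopology

/-- For a t-Henselian topology, the valuation ring of bounded germs is Henselian. -/
theorem IsTHenselian.henselianLocalRing_boundedGerms (hK : IsTHenselian K) :
    HenselianLocalRing (hK.isVTopology.boundedGerms l) := by
  refine ValuationSubring.henselianLocalRing_of_exists_root _ fun n α hα => ?_
  obtain ⟨U, hU, hU0, hroot⟩ := hK.exists_root n
  choose f hf using fun i => Quotient.exists_rep (α i : Germ (l : Filter ι) K)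
  have hf' : ∀ i, ((f i : ι → K) : Germ (l : Filter ι) K) = α i := hf
  have hfU : ∀ᶠ t in (l : Filter ι), ∀ i, f i t ∈ U := by
    refine Filter.eventually_all.mpr fun i => ?_
    have h := (hK.isVTopology.mem_maximalIdeal_boundedGerms l (α i)).mp (hα i)
    rw [← hf' i, Germ.coe_tendsto] at h
    exact h (hU.mem_nhds hU0)
  have hex : ∀ t, ∃ x : K, (∀ i, f i t ∈ U) →
      x ^ (n + 2) + x ^ (n + 1) + ∑ i : Fin (n + 1), f i t * x ^ (i : ℕ) = 0 := by
    intro t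
    by_cases h : ∀ i, f i t ∈ U
    · obtain ⟨x, hx⟩ := hroot (fun i => f i t) h
      exact ⟨x, fun _ => hx⟩
    · exact ⟨0, fun h' => absurd h' h⟩
  choose x hx using hex
  refine ⟨(x : Germ (l : Filter ι) K), ?_⟩
  simp_rw [← hf']
  have hsum : (((fun t => x t ^ (n + 2) + x t ^ (n + 1) +
      ∑ i : Fin (n + 1), f i t * x t ^ (i : ℕ) : ι → K)) : Germ (l : Filter ι) K) =
      (x : Germ (l : Filter ι) K) ^ (n + 2) + (x : Germ (l : Filter ι) K) ^ (n + 1) +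
      ∑ i : Fin (n + 1), (f i : Germ (l : Filter ι) K) * (x : Germ (l : Filter ι) K) ^ (i : ℕ) := by
    have : ((fun t => x t ^ (n + 2) + x t ^ (n + 1) +
      ∑ i : Fin (n + 1), f i t * x t ^ (i : ℕ) : ι → K)) = x ^ (n + 2) + x ^ (n + 1) +
        ∑ i : Fin (n + 1), f i * x ^ (i : ℕ) := by
      ext t; simp
    rw [this]
    change Germ.coeRingHom (R := K) (l : Filter ι) (x ^ (n + 2) + x ^ (n + 1) +
        ∑ i : Fin (n + 1), f i * x ^ (i : ℕ)) = _
    simp only [map_add, map_sum, map_mul, map_pow]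
    rfl
  rw [← hsum]
  exact Germ.coe_eq.mpr (hfU.mono fun t ht => hx t ht)

end BoundedGerms

/-! ### Étale algebras over fields with a t-Henselian topology -/

section EtaleAlgebras

open Polynomial IsLocalRing Filter

namespace IsVTopology

variable {K : Type u} [Field K] [TopologicalSpace K] {ι : Type w} (l : Ultrafilter ι)

/-- A convergent function differs from its limit by an infinitesimal, so reduction modulo the
maximal ideal sees only the limit. -/
theorem mem_maximalIdeal_boundedGerms_iff_eq_zero (hK : IsVTopology K) {f : ι → K} {c : K}
    (hf : Tendsto f l (𝓝 c)) (x : hK.boundedGerms l) (hx : (x : Germ (l : Filter ι) K) = f) :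
    x ∈ maximalIdeal (hK.boundedGerms l) ↔ c = 0 := by
  have := hK.isFieldTopology.t2Space
  rw [hK.mem_maximalIdeal_boundedGerms, hx, Germ.coe_tendsto]
  exact ⟨fun h => tendsto_nhds_unique hf h, fun h => h ▸ hf⟩

end IsVTopology

theorem Algebra.Etale.isEtaleAt {A B : Type*} [CommRing A] [CommRing B] [Algebra A B]
    [Algebra.Etale A B] (Q : Ideal B) [Q.IsPrime] : Algebra.IsEtaleAt A Q := by
  have : Algebra.FormallyEtale B (Localization.AtPrime Q) :=
    Algebra.FormallyEtale.of_isLocalization Q.primeCompl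
  exact Algebra.FormallyEtale.comp A B (Localization.AtPrime Q)

variable {K : Type u} [Field K] [TopologicalSpace K]

/-- Simple roots of monic polynomials are continuous in the coefficients, for a t-Henselian
topology. The coefficients are functions on `ι` that converge along the ultrafilter `l`. -/
theorem IsTHenselian.exists_tendsto_root (hK : IsTHenselian K) {ι : Type w} (l : Ultrafilter ι)
    {A : Type v} [CommRing A] (ev : ι → A →+* K) (φ : A →+* K)
    (hev : ∀ a, Tendsto (fun i => ev i a) l (𝓝 (φ a))) {p : A[X]} (hp : p.Monic) {x₀ : K}
    (hx₀ : p.eval₂ φ x₀ = 0) (hx₀' : p.derivative.eval₂ φ x₀ ≠ 0) :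
    ∃ r : ι → K, Tendsto r l (𝓝 x₀) ∧ ∀ᶠ i in (l : Filter ι), p.eval₂ (ev i) (r i) = 0 := by
  have hV := hK.isVTopology
  have := hV.isTopologicalRing
  have := hK.henselianLocalRing_boundedGerms l
  let O := hV.boundedGerms l
  let evF : A →+* (ι → K) := RingHom.pi ev
  -- The homomorphisms `ev i` assemble into one homomorphism to the bounded germs, infinitely close
  -- to `φ`.
  let evO : A →+* O := ((Germ.coeRingHom (l : Filter ι)).comp evF).codRestrict O
    fun a => hV.mem_boundedGerms_of_tendsto_nhds l (hev a)
  have heval : ∀ (q : A[X]) (r : O) (f : ι → K), (r : Germ (l : Filter ι) K) = f →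
      ((q.eval₂ evO r : O) : Germ (l : Filter ι) K) = ((fun i => q.eval₂ (ev i) (f i) : ι → K)) := by
    intro q r f hrf
    have h1 : ((q.eval₂ evO r : O) : Germ (l : Filter ι) K) =
        q.eval₂ (O.subtype.comp evO) (O.subtype r) := hom_eval₂ q evO O.subtype r
    have h2 : O.subtype.comp evO = (Germ.coeRingHom (l : Filter ι)).comp evF := rfl
    have h3 : O.subtype r = Germ.coeRingHom (l : Filter ι) f := hrf
    rw [h1, h2, h3, ← hom_eval₂]
    change ((_ : ι → K) : Germ (l : Filter ι) K) = _
    congr 1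
    ext i
    exact hom_eval₂ q evF (Pi.evalRingHom _ i) f
  have htend : ∀ q : A[X], Tendsto (fun i => q.eval₂ (ev i) x₀) l (𝓝 (q.eval₂ φ x₀)) := by
    intro q
    simp only [eval₂_eq_sum, Polynomial.sum]
    exact tendsto_finsetSum _ fun i _ => (hev _).mul_const _
  let x : O := ⟨((fun _ => x₀ : ι → K) : Germ (l : Filter ι) K), hV.const_mem_boundedGerms l x₀⟩
  -- The constant germ `x₀` is a simple root modulo infinitesimals, so Hensel's lemma gives an exact
  -- root infinitely close to it.
  obtain ⟨r, hr, hrx⟩ := HenselianLocalRing.is_henselian (p.map evO) (hp.map _) x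
    (by
      rw [Polynomial.eval_map]
      exact (hV.mem_maximalIdeal_boundedGerms_iff_eq_zero l (htend p) _ (heval p x _ rfl)).mpr hx₀)
    (by
      rw [derivative_map, Polynomial.eval_map]
      by_contra h
      exact hx₀' ((hV.mem_maximalIdeal_boundedGerms_iff_eq_zero l (htend p.derivative) _
        (heval _ x _ rfl)).mp ((mem_maximalIdeal _).mpr h)))
  obtain ⟨f, hf⟩ : ∃ f : ι → K, (f : Germ (l : Filter ι) K) = r := Quotient.exists_rep _
  refine ⟨f, ?_, ?_⟩
  · have h1 := (hV.mem_maximalIdeal_boundedGerms l _).mp hrx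
    have h2 : ((r - x : O) : Germ (l : Filter ι) K) = ((fun i => f i - x₀ : ι → K)) := by
      change (r : Germ (l : Filter ι) K) - _ = _
      rw [← hf]
      rfl
    rw [h2, Germ.coe_tendsto] at h1
    simpa using h1.add_const x₀
  · have h1 : (p.eval₂ evO r : O) = 0 := by rw [← Polynomial.eval_map]; exact hr
    have h2 := heval p r f hf.symm
    rw [h1] at h2
    exact (Germ.coe_eq.mp h2.symm)

/-- The image of an étale algebra on points is a neighbourhood, in the topology of pointwise
convergence, of each of its points. -/
theorem IsTHenselian.range_comp_mem_nhds (hK : IsTHenselian K) {A B : Type u} [CommRing A]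
    [Algebra K A] [CommRing B] [Algebra K B] [Algebra A B] [IsScalarTower K A B]
    [Algebra.Etale A B] (φ : B →ₐ[K] K) :
    {ψ : A →ₐ[K] K | ∃ φ' : B →ₐ[K] K, ∀ a, φ' (algebraMap A B a) = ψ a} ∈
      Filter.comap (fun (ψ : A →ₐ[K] K) a => ψ a) (𝓝 fun a => φ (algebraMap A B a)) := by
  have hV := hK.isVTopology
  have := hV.isTopologicalRing
  have := hV.isFieldTopology.t2Space
  -- Testing on ultrafilters turns the claim into lifting almost all points of a family that
  -- converges to the image of `φ`.
  rw [Filter.mem_iff_ultrafilter]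
  intro l hl
  have hev : ∀ a, Tendsto (fun ψ : A →ₐ[K] K => ψ a) l (𝓝 (φ (algebraMap A B a))) :=
    tendsto_pi_nhds.mp (Filter.tendsto_iff_comap.mpr hl)
  have hQ : (RingHom.ker φ.toRingHom).IsPrime := RingHom.ker_isPrime _
  have := Algebra.Etale.isEtaleAt (A := A) (RingHom.ker φ.toRingHom)
  -- Near `ker φ` a point of `B` above `ψ` amounts to a root of the monic polynomial `P.f`,
  -- specialised by `ψ`, at which `P.g` does not vanish.
  obtain ⟨g, hg, hst⟩ := Algebra.IsEtaleAt.exists_isStandardEtale (R := A)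
    (RingHom.ker φ.toRingHom)
  obtain ⟨P⟩ := hst.nonempty_standardEtalePresentation
  have hgu : IsUnit (φ.toRingHom g) := isUnit_iff_ne_zero.mpr hg
  let φ₁ : Localization.Away g →+* K := IsLocalization.Away.lift g hgu
  have hφ₁ : ∀ a : A, φ₁ (algebraMap A _ a) = φ (algebraMap A B a) := by
    intro a
    rw [IsScalarTower.algebraMap_apply A B (Localization.Away g)]
    exact IsLocalization.Away.lift_eq g hgu _
  have hφ₁' : φ₁.comp (algebraMap A _) = (φ : B →+* K).comp (algebraMap A B) := RingHom.ext hφ₁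
  have hev₂ : ∀ q : A[X], q.eval₂ ((φ : B →+* K).comp (algebraMap A B)) (φ₁ P.x) =
      φ₁ (aeval P.x q) := by
    intro q
    rw [← hφ₁', aeval_def, hom_eval₂]
  obtain ⟨r, hr, hroot⟩ := hK.exists_tendsto_root l (fun ψ : A →ₐ[K] K => (ψ : A →+* K))
    ((φ : B →+* K).comp (algebraMap A B)) hev P.monic_f (x₀ := φ₁ P.x)
    (by rw [hev₂, P.hasMap.1, map_zero])
    (by rw [hev₂]; exact (P.hasMap.isUnit_derivative_f.map φ₁).ne_zero)
  have hg₀ : P.g.eval₂ ((φ : B →+* K).comp (algebraMap A B)) (φ₁ P.x) ≠ 0 := by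
    rw [hev₂]; exact (P.hasMap.2.map φ₁).ne_zero
  have hgt : Tendsto (fun ψ : A →ₐ[K] K => P.g.eval₂ (ψ : A →+* K) (r ψ)) l
      (𝓝 (P.g.eval₂ ((φ : B →+* K).comp (algebraMap A B)) (φ₁ P.x))) := by
    simp only [eval₂_eq_sum, Polynomial.sum]
    exact tendsto_finsetSum _ fun i _ => (hev _).mul (hr.pow _)
  change ∀ᶠ ψ in (l : Filter (A →ₐ[K] K)), ∃ φ' : B →ₐ[K] K, ∀ a, φ' (algebraMap A B a) = ψ a
  filter_upwards [hroot, hgt (isOpen_ne.mem_nhds hg₀)] with ψ h1 h2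
  let _ : Algebra A K := (ψ : A →+* K).toAlgebra
  have hmap : P.HasMap (r ψ) := ⟨h1, isUnit_iff_ne_zero.mpr h2⟩
  let χ : Localization.Away g →ₐ[A] K := (P.P.lift _ hmap).comp P.equivRing.toAlgHom
  have hχ : ∀ a, χ (algebraMap B _ (algebraMap A B a)) = ψ a := by
    intro a
    rw [← IsScalarTower.algebraMap_apply A B (Localization.Away g)]
    exact χ.commutes a
  refine ⟨{ (χ : Localization.Away g →+* K).comp (algebraMap B (Localization.Away g)) with
    commutes' := ?_ }, hχ⟩
  intro c
  have := hχ (algebraMap K A c)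
  rw [ψ.commutes, ← IsScalarTower.algebraMap_apply K A B] at this
  exact this

end EtaleAlgebras

/-! ### Étale neighbourhoods with small image -/

section SmallEtaleImages

open Polynomial IsLocalRing Filter

variable {K : Type u} [Field K] [TopologicalSpace K]

theorem IsVTopology.infinite (hK : IsVTopology K) : Infinite K := by
  have := hK.isFieldTopology.t2Space
  by_contra h
  have : Finite K := not_infinite_iff_finite.mp h
  exact hK.not_discrete inferInstance

/-- For a t-Henselian topology, the values of a monic separable polynomial without roots
are bounded away from `0`. -/
theorem IsTHenselian.exists_nhds_forall_eval_notMem (hK : IsTHenselian K) {f : K[X]}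
    (hf : f.Monic) (hdeg : 0 < f.degree) (hsep : f.Separable) (hroot : ∀ x, f.eval x ≠ 0) :
    ∃ W ∈ 𝓝 (0 : K), ∀ x, f.eval x ∉ W := by
  -- Otherwise there is an ultrafilter along which `f` tends to `0`. Its identity germ is then an
  -- approximate root of `f`, and Hensel's lemma yields a true one.
  by_contra! hcon
  have hV := hK.isVTopology
  have : (Filter.comap (fun x => f.eval x) (𝓝 (0 : K))).NeBot := comap_neBot_iff.mpr hcon
  let l : Ultrafilter K := Ultrafilter.of (Filter.comap (fun x => f.eval x) (𝓝 (0 : K)))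
  have hl : Tendsto (fun x => f.eval x) l (𝓝 0) := tendsto_iff_comap.mpr (Ultrafilter.of_le _)
  have := hK.henselianLocalRing_boundedGerms l
  let O := hV.boundedGerms l
  let con : K →+* O := ((Germ.coeRingHom (l : Filter K)).comp (Pi.constRingHom K K)).codRestrict O
    fun a => hV.const_mem_boundedGerms l a
  have heval : ∀ (r : K → K), f.eval₂ (O.subtype.comp con) (r : Germ (l : Filter K) K) =
      ((fun t => f.eval (r t) : K → K) : Germ (l : Filter K) K) := by
    intro r
    have h2 : O.subtype.comp con = (Germ.coeRingHom (l : Filter K)).comp (Pi.constRingHom K K) :=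
      rfl
    have h3 : (r : Germ (l : Filter K) K) = Germ.coeRingHom (l : Filter K) r := rfl
    rw [h2, h3, ← hom_eval₂]
    change ((_ : K → K) : Germ (l : Filter K) K) = _
    congr 1
    ext t
    exact hom_eval₂ f (Pi.constRingHom K K) (Pi.evalRingHom _ t) r
  have hε : ((fun t => f.eval t : K → K) : Germ (l : Filter K) K) ∈ O :=
    hV.mem_boundedGerms_of_tendsto l hl
  let ε : O := ⟨_, hε⟩
  have hεm : ε ∈ maximalIdeal O := (hV.mem_maximalIdeal_boundedGerms l ε).mpr hl
  have hdeg' : (C ε).degree < (f.map con).degree := by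
    rw [hf.degree_map]
    exact degree_C_le.trans_lt hdeg
  -- The identity germ is a root of the monic polynomial `f - ε`, so it is bounded because valuation
  -- rings are integrally closed.
  obtain ⟨x, hx, hx'⟩ := O.exists_eq_of_aeval_eq_zero (f := f.map con - C ε)
    ((hf.map con).sub_of_left hdeg') (z := ((id : K → K) : Germ (l : Filter K) K)) (by
      rw [map_sub, aeval_C, aeval_def, eval₂_map, sub_eq_zero]
      exact heval id)
  have hx : (f.map con).eval x = ε := by
    have h := hx.eq_zero
    rwa [eval_sub, eval_C, sub_eq_zero] at h
  obtain ⟨a, b, hab⟩ := hsep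
  have hu : IsUnit ((f.map con).derivative.eval x) := by
    rw [← notMem_maximalIdeal]
    intro h
    -- The Bézout identity for `f` and its derivative, evaluated at `x`: both values cannot lie in
    -- the maximal ideal.
    have h1 := congrArg (fun p => (p.map con).eval x) hab
    simp only [Polynomial.map_add, Polynomial.map_mul, eval_add, eval_mul, ← derivative_map, hx,
      Polynomial.map_one, eval_one] at h1
    refine (Ideal.ne_top_iff_one _).mp (maximalIdeal.isMaximal O).ne_top ?_
    rw [← h1]
    exact add_mem (Ideal.mul_mem_left _ _ hεm) (Ideal.mul_mem_left _ _ h)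
  obtain ⟨r, hr, -⟩ := HenselianLocalRing.is_henselian (f.map con) (hf.map _) x (hx ▸ hεm) hu
  obtain ⟨g, hg⟩ : ∃ g : K → K, (g : Germ (l : Filter K) K) = r := Quotient.exists_rep _
  have h := heval g
  rw [hg] at h
  have h1 : f.eval₂ (O.subtype.comp con) (O.subtype r) = 0 := by
    rw [← hom_eval₂, ← Polynomial.eval_map, hr.eq_zero, map_zero]
  obtain ⟨t, ht⟩ := (Germ.coe_eq.mp (h.symm.trans h1)).exists
  exact hroot _ ht

/-- If `K` is not separably closed, then for every `K`-algebra `A`, a point `φ` and `a ∈ A`,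
there is an étale neighbourhood of `φ` on whose points `a` takes values in a given neighbourhood
of `φ a`. -/
theorem IsTHenselian.exists_etale_forall_apply_mem (hK : IsTHenselian K) (hsep : ¬ IsSepClosed K)
    {A : Type u} [CommRing A] [Algebra K A] (φ : A →ₐ[K] K) (a : A) {U : Set K}
    (hU : U ∈ 𝓝 (φ a)) :
    ∃ (B : Type u) (_ : CommRing B) (_ : Algebra K B) (_ : Algebra A B) (_ : IsScalarTower K A B)
      (_ : Algebra.Etale A B), (∃ ψ : B →ₐ[K] K, ∀ x, ψ (algebraMap A B x) = φ x) ∧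
        ∀ ψ : B →ₐ[K] K, ψ (algebraMap A B a) ∈ U := by
  have hV := hK.isVTopology
  have := hV.isTopologicalRing
  have := hV.infinite
  obtain ⟨f, hf, hdeg, hfs, hfr⟩ : ∃ f : K[X], f.Monic ∧ 0 < f.degree ∧ f.Separable ∧
      ∀ x, f.eval x ≠ 0 := by
    by_contra! h
    exact hsep (IsSepClosed.of_exists_root K fun p hp hpi hps =>
      h p hp hpi.degree_pos hps)
  -- Separability makes the derivative a nonzero polynomial, and a field with a V-topology is
  -- infinite. The point `x₀` will be the simple root lying above `φ`.
  obtain ⟨x₀, hx₀⟩ : ∃ x, f.derivative.eval x ≠ 0 := by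
    by_contra! h
    have h0 : f.derivative = 0 := Polynomial.funext fun x => by rw [h x, eval_zero]
    rw [Separable, h0, isCoprime_zero_right] at hfs
    exact hdeg.ne' (degree_eq_zero_of_isUnit hfs)
  obtain ⟨W, hW, hfW⟩ := hK.exists_nhds_forall_eval_notMem hf hdeg hfs hfr
  obtain ⟨T, hT, hT0, hTU⟩ : ∃ T : Set K, IsOpen T ∧ (0 : K) ∈ T ∧
      ∀ s ∈ T, ∀ t ∈ T, φ a + s - t ∈ U := by
    have hc : Tendsto (fun p : K × K => φ a + p.1 - p.2) (𝓝 0 ×ˢ 𝓝 0) (𝓝 (φ a)) := by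
      have : Continuous fun p : K × K => φ a + p.1 - p.2 := by fun_prop
      have := this.tendsto (0, 0)
      rwa [nhds_prod_eq, add_zero, sub_zero] at this
    obtain ⟨T₁, hT₁, T₂, hT₂, hT'⟩ := Filter.mem_prod_iff.mp (hc hU)
    obtain ⟨T, hTW, hT, hT0⟩ := mem_nhds_iff.mp (inter_mem hT₁ hT₂)
    exact ⟨T, hT, hT0, fun s hs t ht => hT' (Set.mk_mem_prod (hTW hs).1 (hTW ht).2)⟩
  obtain ⟨c, hc, hcT⟩ := hV.bounded_inv W hW T hT hT0
  have hcT : ∀ x, c * (f.eval x)⁻¹ ∈ T := fun x => hcT _ ⟨_, hfW x, rfl⟩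
  -- The cover is given by `f(y) = c / b` where `b` is invertible, with `f'(y)` inverted as well. On
  -- it `b = c / f(y)`, and `y = x₀` lies above `φ`.
  let b : A := a - algebraMap K A (φ a - c * (f.eval x₀)⁻¹)
  have hφb : φ b = c * (f.eval x₀)⁻¹ := by simp [b]
  have hbu : IsUnit (φ.toRingHom b) := by
    refine isUnit_iff_ne_zero.mpr ?_
    change φ b ≠ 0
    rw [hφb]
    exact mul_ne_zero hc (inv_ne_zero (hfr x₀))
  let A' := Localization.Away b
  let ib : A' := IsLocalization.Away.invSelf b
  have hib : algebraMap A A' b * ib = 1 := IsLocalization.Away.mul_invSelf b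
  let F : A'[X] := f.map (algebraMap K A') - C (algebraMap K A' c * ib)
  have hF : F.Monic := by
    rcases subsingleton_or_nontrivial A' with h | h
    · exact Subsingleton.elim _ _
    · refine (hf.map _).sub_of_left (degree_C_le.trans_lt ?_)
      rwa [hf.degree_map]
  let P : StandardEtalePair A' := ⟨F, hF, F.derivative, 1, 0, 1, by simp⟩
  let _ : Algebra A P.Ring := ((algebraMap A' P.Ring).comp (algebraMap A A')).toAlgebra
  have : IsScalarTower A A' P.Ring := .of_algebraMap_eq fun _ => rfl
  let _ : Algebra K P.Ring := ((algebraMap A' P.Ring).comp (algebraMap K A')).toAlgebra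
  have : IsScalarTower K A' P.Ring := .of_algebraMap_eq fun _ => rfl
  have : IsScalarTower K A P.Ring := .of_algebraMap_eq fun k => by
    rw [IsScalarTower.algebraMap_apply K A' P.Ring, IsScalarTower.algebraMap_apply K A A',
      ← IsScalarTower.algebraMap_apply A A' P.Ring]
  have : Algebra.Etale A A' := .of_isLocalizationAway b
  have : Algebra.Etale A P.Ring := .comp A A' P.Ring
  refine ⟨P.Ring, inferInstance, inferInstance, inferInstance, inferInstance, inferInstance,
    ?_, ?_⟩
  · let φ₁ : A' →+* K := IsLocalization.Away.lift b hbu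
    have hφ₁ : ∀ x : A, φ₁ (algebraMap A _ x) = φ x := IsLocalization.Away.lift_eq b hbu
    have hφ₁K : φ₁.comp (algebraMap K A') = RingHom.id K := by
      ext k
      rw [RingHom.comp_apply, IsScalarTower.algebraMap_apply K A A', hφ₁, φ.commutes]; rfl
    have hφib : φ₁ ib = c⁻¹ * f.eval x₀ := by
      have h := congrArg φ₁ hib
      rw [map_mul, hφ₁, hφb, map_one] at h
      have := hfr x₀
      field_simp at h ⊢
      linear_combination h
    let _ : Algebra A' K := φ₁.toAlgebra
    have hm : P.HasMap x₀ := by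
      constructor
      · change F.eval₂ φ₁ x₀ = 0
        have h1 : φ₁ (algebraMap K A' c) = c := congrArg (fun g => g c) hφ₁K
        rw [eval₂_sub, eval₂_map, hφ₁K, eval₂_C, map_mul, hφib, h1, mul_inv_cancel_left₀ hc]
        exact sub_self _
      · change IsUnit (F.derivative.eval₂ φ₁ x₀)
        rw [derivative_sub, derivative_C, sub_zero, derivative_map, eval₂_map, hφ₁K]
        exact isUnit_iff_ne_zero.mpr hx₀
    have hl : ∀ x, P.lift x₀ hm (algebraMap A P.Ring x) = φ x := fun x =>
      ((P.lift x₀ hm).commutes _).trans (hφ₁ x)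
    refine ⟨{ (P.lift x₀ hm : P.Ring →+* K) with commutes' := fun k => ?_ }, hl⟩
    have := hl (algebraMap K A k)
    rw [φ.commutes, ← IsScalarTower.algebraMap_apply K A P.Ring] at this
    exact this
  · intro ψ
    set x := ψ P.X
    let ψ' : A' →+* K := (ψ : P.Ring →+* K).comp (algebraMap A' P.Ring)
    have hψK' : ∀ k, ψ' (algebraMap K A' k) = k := fun k => ψ.commutes k
    have hψK : ψ'.comp (algebraMap K A') = RingHom.id K := RingHom.ext hψK'
    have h1 : F.eval₂ ψ' x = 0 := by
      have h := congrArg (ψ : P.Ring →+* K) P.hasMap_X.1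
      rw [aeval_def, hom_eval₂, map_zero] at h
      exact h
    rw [eval₂_sub, eval₂_map, hψK, eval₂_C, map_mul, hψK', sub_eq_zero] at h1
    have h3 := congrArg ψ' hib
    rw [map_mul, map_one] at h3
    have h4 : ψ' (algebraMap A A' b) = c * (f.eval x)⁻¹ := by
      have : f.eval x = c * ψ' ib := h1
      have h5 := hfr x
      rw [this] at h5 ⊢
      have h6 : ψ' ib ≠ 0 := right_ne_zero_of_mul h5
      field_simp
      exact h3
    have h5 : ψ (algebraMap A P.Ring a) = φ a + c * (f.eval x)⁻¹ - c * (f.eval x₀)⁻¹ := by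
      have h6 : ψ' (algebraMap A A' b) = ψ (algebraMap A P.Ring a) -
          (φ a - c * (f.eval x₀)⁻¹) := by
        simp only [b, map_sub]
        rw [← IsScalarTower.algebraMap_apply K A A', ← IsScalarTower.algebraMap_apply K A A', hψK', hψK']
        rfl
      linear_combination h4 - h6
    rw [h5]
    exact hTU _ (hcT x) _ (hcT x₀)

end SmallEtaleImages

/-! ### Affine varieties -/

namespace Variety

variable (K : Type u) [Field K]

/-- The affine `K`-variety `Spec A` of a finitely generated `K`-algebra `A`. -/
noncomputable def spec (A : Type u) [CommRing A] [Algebra K A] [Algebra.FiniteType K A] :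
    Variety K where
  toOver := Over.mk (Spec.map (CommRingCat.ofHom (algebraMap K A)))
  locallyOfFiniteType := by
    refine (HasRingHomProperty.Spec_iff (P := @LocallyOfFiniteType)).mpr ?_
    exact RingHom.finiteType_algebraMap.mpr inferInstance
  quasiCompact := by dsimp; infer_instance
  isSeparated := by dsimp; infer_instance

variable {K}
variable {A B : Type u} [CommRing A] [Algebra K A] [Algebra.FiniteType K A]
  [CommRing B] [Algebra K B] [Algebra.FiniteType K B]

/-- The morphism of affine varieties given by a homomorphism of `K`-algebras. -/
noncomputable def specMap (f : A →ₐ[K] B) : (spec K B).toOver ⟶ (spec K A).toOver :=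
  Over.homMk (U := (spec K B).toOver) (V := (spec K A).toOver)
    (Spec.map (CommRingCat.ofHom (f : A →+* B))) (by
      dsimp [spec]
      rw [← Spec.map_comp, ← CommRingCat.ofHom_comp, AlgHom.comp_algebraMap])

theorem exists_specMap_eq (g : (spec K B).toOver ⟶ (spec K A).toOver) :
    ∃ f : A →ₐ[K] B, specMap f = g := by
  let f' : CommRingCat.of A ⟶ CommRingCat.of B := Spec.preimage g.left
  have hf' : Spec.map f' = g.left := Spec.map_preimage _
  have hw : Spec.map f' ≫ Spec.map (CommRingCat.ofHom (algebraMap K A)) =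
      Spec.map (CommRingCat.ofHom (algebraMap K B)) :=
    (congrArg (· ≫ Spec.map (CommRingCat.ofHom (algebraMap K A))) hf').trans (Over.w g)
  rw [← Spec.map_comp] at hw
  have h := Spec.map_injective hw
  refine ⟨{ f'.hom with commutes' := fun k => congrArg (fun t => t.hom k) h }, ?_⟩
  exact Over.OverMorphism.ext hf'

/-- The `K`-point of `Spec A` given by a homomorphism of `K`-algebras `A → K`. -/
noncomputable def specPointOf (φ : A →ₐ[K] K) : (spec K A).Points :=
  Over.homMk (U := Over.mk (𝟙 (Spec (CommRingCat.of K)))) (V := (spec K A).toOver)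
    (Spec.map (CommRingCat.ofHom (φ : A →+* K))) (by
      dsimp [spec]
      rw [← Spec.map_comp, ← CommRingCat.ofHom_comp, AlgHom.comp_algebraMap, ← Spec.map_id]
      rfl)

theorem exists_specPointOf_eq (p : (spec K A).Points) : ∃ φ : A →ₐ[K] K, specPointOf φ = p := by
  let f' : CommRingCat.of A ⟶ CommRingCat.of K := Spec.preimage p.left
  have hf' : Spec.map f' = p.left := Spec.map_preimage _
  have hw : Spec.map f' ≫ Spec.map (CommRingCat.ofHom (algebraMap K A)) =
      𝟙 (Spec (CommRingCat.of K)) :=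
    (congrArg (· ≫ Spec.map (CommRingCat.ofHom (algebraMap K A))) hf').trans (Over.w p)
  rw [← Spec.map_comp, ← Spec.map_id] at hw
  have h := Spec.map_injective hw
  refine ⟨{ f'.hom with commutes' := fun k => congrArg (fun t => t.hom k) h }, ?_⟩
  exact Over.OverMorphism.ext hf'

theorem specPointOf_injective : Function.Injective (specPointOf (K := K) (A := A)) := by
  intro φ ψ h
  have h1 : Spec.map (CommRingCat.ofHom (φ : A →+* K)) =
    Spec.map (CommRingCat.ofHom (ψ : A →+* K)) := congrArg (fun t => t.left) h
  have h2 := congrArg CommRingCat.Hom.hom (Spec.map_injective h1)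
  ext a
  exact congrArg (fun t => t a) h2

variable (K A) in
/-- The `K`-points of `Spec A` are the homomorphisms of `K`-algebras `A → K`. -/
noncomputable def specPoints : (A →ₐ[K] K) ≃ (spec K A).Points :=
  Equiv.ofBijective specPointOf ⟨specPointOf_injective, exists_specPointOf_eq⟩

theorem mapPoints_specPointOf (f : A →ₐ[K] B) (φ : B →ₐ[K] K) :
    mapPoints (specMap f) (specPoints K B φ) = specPoints K A (φ.comp f) := by
  apply Over.OverMorphism.ext
  change Spec.map _ ≫ Spec.map _ = Spec.map _
  rw [← Spec.map_comp]
  rfl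

theorem etale_specMap_iff (f : A →ₐ[K] B) :
    Etale (specMap f).left ↔ (f : A →+* B).Etale :=
  HasRingHomProperty.Spec_iff (P := @Etale)

theorem mapPoints_comp {V W Z : Variety K} (f : V.toOver ⟶ W.toOver) (g : W.toOver ⟶ Z.toOver)
    (p : V.Points) : mapPoints (f ≫ g) p = mapPoints g (mapPoints f p) :=
  (Category.assoc p f g).symm

/-- Every `K`-point of a variety lies in an affine chart. -/
theorem exists_chart (V : Variety K) (q : V.Points) :
    ∃ (A : Type u) (_ : CommRing A) (_ : Algebra K A) (_ : Algebra.FiniteType K A)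
      (j : (spec K A).toOver ⟶ V.toOver), IsOpenImmersion j.left ∧ q ∈ Set.range (mapPoints j) := by
  have := V.locallyOfFiniteType
  let q' : Spec (CommRingCat.of K) ⟶ V.toOver.left := q.left
  have hw : q' ≫ V.toOver.hom = 𝟙 _ := Over.w q
  let pt : Spec (CommRingCat.of K) := default
  obtain ⟨U, hU, hq, -⟩ := exists_isAffineOpen_mem_and_subset (X := V.toOver.left)
    (x := q' pt) (U := ⊤) trivial
  let A := Γ(V.toOver.left, U)
  let s : Spec A ⟶ V.toOver.left := hU.fromSpec
  have hs : IsOpenImmersion s := inferInstanceAs (IsOpenImmersion hU.fromSpec)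
  let f : CommRingCat.of K ⟶ A := Spec.preimage (s ≫ V.toOver.hom)
  have hf : Spec.map f = s ≫ V.toOver.hom := Spec.map_preimage _
  let _ : Algebra K A := f.hom.toAlgebra
  have hfin : Algebra.FiniteType K A := by
    rw [← RingHom.finiteType_algebraMap]
    refine (HasRingHomProperty.Spec_iff (P := @LocallyOfFiniteType) (φ := f)).mp ?_
    rw [hf]
    infer_instance
  let j : (spec K A).toOver ⟶ V.toOver := Over.homMk (U := (spec K A).toOver) s hf.symm
  refine ⟨A, inferInstance, inferInstance, hfin, j, hs, ?_⟩
  -- `Spec K` has one point, so factoring through the open immersion is a condition on that point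
  -- alone.
  have hrange : Set.range q' ⊆ Set.range s := by
    rintro _ ⟨x, rfl⟩
    rw [Subsingleton.elim x pt, hU.range_fromSpec]
    exact hq
  let r : Spec (CommRingCat.of K) ⟶ Spec A := IsOpenImmersion.lift s q' hrange
  have hr : r ≫ s = q' := IsOpenImmersion.lift_fac s q' hrange
  have hr' : r ≫ Spec.map f = 𝟙 _ := by rw [hf, ← Category.assoc, hr, hw]
  exact ⟨Over.homMk (U := Over.mk (𝟙 (Spec (CommRingCat.of K)))) (V := (spec K A).toOver) r hr',
    Over.OverMorphism.ext hr⟩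

-- This is the universal property of the pullback, transported to an isomorphic model `T`. It will
-- be used with `T` the spectrum of a quotient ring, the form that a closed subscheme of an affine
-- scheme takes.
open Limits in
theorem _root_.AlgebraicGeometry.isOpenImmersion_inv_comp_pullback_fst {V W S T : Scheme.{u}}
    (i : V ⟶ W) (j : S ⟶ W) [IsOpenImmersion j] (e : pullback i j ≅ T) (m : T ⟶ S)
    (he : pullback.snd i j = e.hom ≫ m) :
    IsOpenImmersion (e.inv ≫ pullback.fst i j) ∧ (e.inv ≫ pullback.fst i j) ≫ i = m ≫ j ∧
      ∀ {Z : Scheme.{u}} (x : Z ⟶ V) (y : Z ⟶ S), x ≫ i = y ≫ j →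
        ∃ z : Z ⟶ T, z ≫ (e.inv ≫ pullback.fst i j) = x ∧ z ≫ m = y := by
  refine ⟨inferInstance, ?_, fun x y h => ⟨pullback.lift x y h ≫ e.hom, ?_, ?_⟩⟩
  · rw [Category.assoc, pullback.condition, he, Category.assoc, e.inv_hom_id_assoc]
  · rw [Category.assoc, e.hom_inv_id_assoc, pullback.lift_fst]
  · rw [Category.assoc, ← he, pullback.lift_snd]

/-- The pullback of a closed immersion along an affine chart is an affine chart, and is cut out by
an ideal. -/
theorem exists_chart_of_isClosedImmersion {V W : Variety K} (i : V.toOver ⟶ W.toOver)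
    (hi : IsClosedImmersion i.left) (j : (spec K A).toOver ⟶ W.toOver)
    (hj : IsOpenImmersion j.left) :
    ∃ (I : Ideal A) (k : (spec K (A ⧸ I)).toOver ⟶ V.toOver), IsOpenImmersion k.left ∧
      k ≫ i = specMap (Ideal.Quotient.mkₐ K I) ≫ j ∧
      ∀ (x : V.Points) (y : (spec K A).Points), mapPoints i x = mapPoints j y →
        ∃ z, mapPoints k z = x ∧ mapPoints (specMap (Ideal.Quotient.mkₐ K I)) z = y := by
  let jl : Spec (CommRingCat.of A) ⟶ W.toOver.left := j.left
  have hjl : IsOpenImmersion jl := hj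
  let π : Limits.pullback i.left jl ⟶ Spec (CommRingCat.of A) := Limits.pullback.snd i.left jl
  have hπ : IsClosedImmersion π := inferInstanceAs (IsClosedImmersion (Limits.pullback.snd i.left jl))
  obtain ⟨I, e, he⟩ := IsClosedImmersion.Spec_iff.mp hπ
  change Ideal A at I
  let mkI : (spec K (A ⧸ I)).toOver ⟶ (spec K A).toOver := specMap (Ideal.Quotient.mkₐ K I)
  obtain ⟨h1, h2, h3⟩ := isOpenImmersion_inv_comp_pullback_fst i.left jl e _ he
  have hiW : i.left ≫ W.toOver.hom = V.toOver.hom := Over.w i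
  have hjW : jl ≫ W.toOver.hom = (spec K A).toOver.hom := Over.w j
  have hmk : Spec.map (CommRingCat.ofHom (Ideal.Quotient.mk I)) ≫ (spec K A).toOver.hom =
    (spec K (A ⧸ I)).toOver.hom := Over.w mkI
  let k : (spec K (A ⧸ I)).toOver ⟶ V.toOver :=
    Over.homMk (U := (spec K (A ⧸ I)).toOver) (e.inv ≫ Limits.pullback.fst i.left jl) (by
      have h4 := congrArg (· ≫ W.toOver.hom) h2
      simp only [Category.assoc, hiW, hjW] at h4
      exact ((Category.assoc _ _ _).trans h4).trans hmk)
  refine ⟨I, k, h1, Over.OverMorphism.ext h2, fun x y hxy => ?_⟩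
  obtain ⟨z, hz, hz'⟩ := h3 x.left y.left (congrArg (fun t => t.left) hxy)
  have hzw : z ≫ (spec K (A ⧸ I)).toOver.hom = 𝟙 _ :=
    (congrArg (z ≫ ·) hmk.symm).trans ((Category.assoc _ _ _).symm.trans
      ((congrArg (· ≫ (spec K A).toOver.hom) hz').trans (Over.w y)))
  exact ⟨Over.homMk (U := Over.mk (𝟙 (Spec (CommRingCat.of K))))
    (V := (spec K (A ⧸ I)).toOver) z hzw, Over.OverMorphism.ext hz, Over.OverMorphism.ext hz'⟩

end Variety

/-! ### The étale-open topology is a system of topologies -/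

section EtaleOpen

open Variety

variable {K : Type u} [Field K]

theorem isOpen_range_mapPoints {V W : Variety K} (f : V.toOver ⟶ W.toOver) (hf : Etale f.left) :
    IsOpen[etaleOpen K W] (Set.range (mapPoints f)) :=
  TopologicalSpace.isOpen_generateFrom_of_mem ⟨V, f, hf, rfl⟩

/-- Morphisms of varieties induce maps that are continuous for the étale-open topology. -/
theorem continuous_mapPoints_etaleOpen {V W : Variety K} (g : V.toOver ⟶ W.toOver) :
    @Continuous _ _ (etaleOpen K V) (etaleOpen K W) (mapPoints g) := by
  let := etaleOpen K V
  refine continuous_generateFrom_iff.mpr ?_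
  rintro _ ⟨X, f, hf, rfl⟩
  have := X.locallyOfFiniteType
  have := X.quasiCompact
  have := X.isSeparated
  have := V.locallyOfFiniteType
  have := V.quasiCompact
  have := V.isSeparated
  have := W.isSeparated
  have hfX : f.left ≫ W.toOver.hom = X.toOver.hom := Over.w f
  have hgV : g.left ≫ W.toOver.hom = V.toOver.hom := Over.w g
  have : IsSeparated f.left := by
    have : IsSeparated (f.left ≫ W.toOver.hom) := by rw [hfX]; infer_instance
    exact IsSeparated.of_comp f.left W.toOver.hom
  have : QuasiCompact f.left := by
    have : QuasiCompact (f.left ≫ W.toOver.hom) := by rw [hfX]; infer_instance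
    exact QuasiCompact.of_comp f.left W.toOver.hom
  -- The preimage of an étale image is the image of the base change, which is again étale.
  let P : Variety K :=
    { toOver := Over.mk (Limits.pullback.fst g.left f.left ≫ V.toOver.hom)
      locallyOfFiniteType := by dsimp; infer_instance
      quasiCompact := by dsimp; infer_instance
      isSeparated := by dsimp; infer_instance }
  let q : P.toOver ⟶ V.toOver := Over.homMk (Limits.pullback.fst g.left f.left)
  let r : P.toOver ⟶ X.toOver := Over.homMk (Limits.pullback.snd g.left f.left) (by
    dsimp [P]
    rw [← hgV, ← hfX, Limits.pullback.condition_assoc])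
  have hqr : q ≫ g = r ≫ f := by
    ext1
    exact Limits.pullback.condition
  have heq : mapPoints g ⁻¹' Set.range (mapPoints f) = Set.range (mapPoints q) := by
    ext y
    constructor
    · rintro ⟨b, hb⟩
      have hb' : b ≫ f = y ≫ g := hb
      have hw : y.left ≫ g.left = b.left ≫ f.left := by
        rw [← Over.comp_left, ← Over.comp_left, hb']
      have hy : y.left ≫ V.toOver.hom = 𝟙 _ := Over.w y
      refine ⟨Over.homMk (Limits.pullback.lift y.left b.left hw) ?_, ?_⟩
      · change Limits.pullback.lift y.left b.left _ ≫ Limits.pullback.fst g.left f.left ≫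
          V.toOver.hom = 𝟙 _
        rw [Limits.pullback.lift_fst_assoc, hy]
      · exact Over.OverMorphism.ext (Limits.pullback.lift_fst _ _ _)
    · rintro ⟨c, rfl⟩
      exact ⟨mapPoints r c, by rw [← mapPoints_comp, ← mapPoints_comp, hqr]⟩
  rw [heq]
  exact isOpen_range_mapPoints q (inferInstanceAs (Etale (Limits.pullback.fst g.left f.left)))

/-- Étale morphisms induce maps that are open for the étale-open topology. -/
theorem isOpenMap_mapPoints_etaleOpen {V W : Variety K} (g : V.toOver ⟶ W.toOver)
    (hg : Etale g.left) : @IsOpenMap _ _ (etaleOpen K V) (etaleOpen K W) (mapPoints g) := by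
  let := etaleOpen K V
  let := etaleOpen K W
  refine (isTopologicalBasis_etaleImages V).isOpenMap_iff.mpr ?_
  rintro _ ⟨X, f, hf, rfl⟩
  have h : mapPoints g '' Set.range (mapPoints f) = Set.range (mapPoints (f ≫ g)) := by
    rw [← Set.range_comp]
    congr 1
  rw [h]
  exact isOpen_range_mapPoints _ (inferInstanceAs (Etale (f.left ≫ g.left)))

theorem mapPoints_injective {V W : Variety K} (g : V.toOver ⟶ W.toOver) (hg : Mono g.left) :
    Function.Injective (mapPoints g) := by
  intro p q h
  exact Over.OverMorphism.ext ((cancel_mono g.left).mp (congrArg (fun t => t.left) h))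

theorem isOpenEmbedding_mapPoints_etaleOpen {V W : Variety K} (g : V.toOver ⟶ W.toOver)
    (hg : IsOpenImmersion g.left) :
    @IsOpenEmbedding _ _ (etaleOpen K V) (etaleOpen K W) (mapPoints g) := by
  let := etaleOpen K V
  let := etaleOpen K W
  exact .of_continuous_injective_isOpenMap (continuous_mapPoints_etaleOpen g)
    (mapPoints_injective g inferInstance) (isOpenMap_mapPoints_etaleOpen g inferInstance)

/-- If closed immersions of affine varieties induce closed embeddings for the étale-open topology,
then all closed immersions do. -/
theorem isClosedEmbedding_mapPoints_etaleOpen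
    (H : ∀ (A : Type u) [CommRing A] [Algebra K A] [Algebra.FiniteType K A] (I : Ideal A),
      @IsClosedEmbedding _ _ (etaleOpen K (spec K (A ⧸ I))) (etaleOpen K (spec K A))
        (mapPoints (specMap (Ideal.Quotient.mkₐ K I))))
    {V W : Variety K} (i : V.toOver ⟶ W.toOver) (hi : IsClosedImmersion i.left) :
    @IsClosedEmbedding _ _ (etaleOpen K V) (etaleOpen K W) (mapPoints i) := by
  let := etaleOpen K V
  let := etaleOpen K W
  have hinj := mapPoints_injective i inferInstance
  -- Both the inducing property and closedness of the range are local on the target. By `hlift`,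
  -- points of `V` over a chart `Spec A` come from the corresponding chart `Spec (A ⧸ I)`.
  refine ⟨⟨isInducing_iff_nhds.mpr fun p => le_antisymm ?_ ?_, hinj⟩,
    isOpen_compl_iff.mp (isOpen_iff_mem_nhds.mpr fun q hq => ?_)⟩
  · exact ((continuous_mapPoints_etaleOpen i).tendsto p).le_comap
  · obtain ⟨A, _, _, _, j, hj, y, hy⟩ := exists_chart W (mapPoints i p)
    obtain ⟨I, k, hk, hkj, hlift⟩ := exists_chart_of_isClosedImmersion i hi j hj
    let := etaleOpen K (spec K A)
    let := etaleOpen K (spec K (A ⧸ I))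
    obtain ⟨z, rfl, rfl⟩ := hlift p y hy.symm
    have hjo := isOpenEmbedding_mapPoints_etaleOpen j hj
    have hko := isOpenEmbedding_mapPoints_etaleOpen k hk
    intro S hS
    rw [← hko.map_nhds_eq, Filter.mem_map, (H A I).isInducing.nhds_eq_comap] at hS
    obtain ⟨T, hT, hTS⟩ := hS
    refine ⟨mapPoints j '' T, ?_, ?_⟩
    · rw [← hy, ← hjo.map_nhds_eq]
      exact Filter.image_mem_map hT
    · rintro x ⟨t, ht, htx⟩
      obtain ⟨z', rfl, rfl⟩ := hlift x t htx.symm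
      exact hTS ht
  · obtain ⟨A, _, _, _, j, hj, y, rfl⟩ := exists_chart W q
    obtain ⟨I, k, hk, hkj, hlift⟩ := exists_chart_of_isClosedImmersion i hi j hj
    let := etaleOpen K (spec K A)
    let := etaleOpen K (spec K (A ⧸ I))
    have hjo := isOpenEmbedding_mapPoints_etaleOpen j hj
    have hy : y ∈ (Set.range (mapPoints (specMap (Ideal.Quotient.mkₐ K I))))ᶜ := by
      rintro ⟨z, rfl⟩
      exact hq ⟨mapPoints k z, by rw [← mapPoints_comp, hkj, mapPoints_comp]⟩
    have hopen := (H A I).isClosed_range.isOpen_compl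
    rw [← hjo.map_nhds_eq]
    refine Filter.mem_of_superset (Filter.image_mem_map (hopen.mem_nhds hy)) ?_
    rintro _ ⟨t, ht, rfl⟩ ⟨x, hx⟩
    obtain ⟨z, -, hz⟩ := hlift x t hx
    exact ht ⟨z, hz⟩

end EtaleOpen

/-! ### Comparison with a t-Henselian topology -/

section Comparison

open Variety

variable {K : Type u} [Field K] [TopologicalSpace K]

variable (K) in
/-- The topology of pointwise convergence on the `K`-points of `Spec A`. -/
@[reducible] noncomputable def pointwiseTopology (A : Type u) [CommRing A] [Algebra K A]
    [Algebra.FiniteType K A] : TopologicalSpace (spec K A).Points :=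
  TopologicalSpace.induced (fun p a => (specPoints K A).symm p a) Pi.topologicalSpace

/-- On affine varieties, the étale-open topology is the topology of pointwise convergence. -/
theorem IsTHenselian.etaleOpen_spec_eq (hK : IsTHenselian K) (hsep : ¬ IsSepClosed K)
    (A : Type u) [CommRing A] [Algebra K A] [Algebra.FiniteType K A] :
    etaleOpen K (spec K A) = pointwiseTopology K A := by
  apply le_antisymm
  · let := etaleOpen K (spec K A)
    -- Étale-open is finer: each evaluation is continuous because étale neighbourhoods can be made
    -- small.
    rw [← continuous_iff_le_induced]
    refine continuous_pi fun a => continuous_def.mpr fun U hU => ?_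
    refine isOpen_iff_forall_mem_open.mpr fun p hp => ?_
    obtain ⟨φ, rfl⟩ := (specPoints K A).surjective p
    rw [Set.mem_preimage, Equiv.symm_apply_apply] at hp
    obtain ⟨B, _, _, _, _, _, ⟨ψ, hψ⟩, hB⟩ :=
      hK.exists_etale_forall_apply_mem hsep φ a (hU.mem_nhds hp)
    have : Algebra.FiniteType K B := Algebra.FiniteType.trans (S := A) inferInstance inferInstance
    let f : A →ₐ[K] B := IsScalarTower.toAlgHom K A B
    have hf : (f : A →+* B).Etale := RingHom.etale_algebraMap.mpr inferInstance
    refine ⟨Set.range (mapPoints (specMap f)), ?_,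
      isOpen_range_mapPoints _ ((etale_specMap_iff f).mpr hf), ?_⟩
    · rintro _ ⟨q, rfl⟩
      obtain ⟨χ, rfl⟩ := (specPoints K B).surjective q
      rw [mapPoints_specPointOf, Set.mem_preimage, Equiv.symm_apply_apply]
      exact hB χ
    · refine ⟨specPoints K B ψ, ?_⟩
      rw [mapPoints_specPointOf]
      congr 1
      ext x
      exact hψ x
  -- Étale images are open for pointwise convergence: a chart of `X` around the chosen point makes
  -- the étale map one of algebras.
  · refine le_generateFrom ?_
    rintro _ ⟨X, g, hg, rfl⟩
    let := pointwiseTopology K A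
    refine isOpen_iff_mem_nhds.mpr ?_
    rintro _ ⟨x, rfl⟩
    obtain ⟨B, _, _, _, j, hj, y, rfl⟩ := exists_chart X x
    obtain ⟨φ, rfl⟩ := (specPoints K B).surjective y
    obtain ⟨f, hf⟩ := exists_specMap_eq (j ≫ g)
    have hfe : Etale (specMap f).left := by
      rw [hf]
      exact inferInstanceAs (Etale (j.left ≫ g.left))
    rw [etale_specMap_iff] at hfe
    let _ : Algebra A B := (f : A →+* B).toAlgebra
    have : IsScalarTower K A B := .of_algebraMap_eq fun k => (f.commutes k).symm
    have : Algebra.Etale A B := hfe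
    have h := hK.range_comp_mem_nhds (A := A) φ
    rw [← mapPoints_comp, ← hf, mapPoints_specPointOf, nhds_induced]
    obtain ⟨T, hT, hTS⟩ := h
    refine ⟨T, ?_, ?_⟩
    · rw [Equiv.symm_apply_apply]
      exact hT
    · intro p hp
      obtain ⟨ψ, rfl⟩ := (specPoints K A).surjective p
      rw [Set.mem_preimage, Equiv.symm_apply_apply] at hp
      obtain ⟨φ', hφ'⟩ := hTS hp
      refine ⟨mapPoints j (specPoints K B φ'), ?_⟩
      rw [← mapPoints_comp, ← hf, mapPoints_specPointOf]
      congr 1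
      ext a
      exact hφ' a

/-- Points of `A ⧸ I` are the points of `A` that kill `I`. Each vanishing condition is closed, and
evaluation at a class is evaluation at any representative. -/
theorem isClosedEmbedding_pointwiseTopology [T1Space K] (A : Type u) [CommRing A] [Algebra K A]
    [Algebra.FiniteType K A] (I : Ideal A) :
    @IsClosedEmbedding _ _ (pointwiseTopology K (A ⧸ I)) (pointwiseTopology K A)
      (mapPoints (specMap (Ideal.Quotient.mkₐ K I))) := by
  let := pointwiseTopology K A
  let := pointwiseTopology K (A ⧸ I)
  have hev : ∀ a : A, Continuous fun p : (spec K A).Points => (specPoints K A).symm p a :=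
    fun a => (continuous_apply a).comp continuous_induced_dom
  have hval : ∀ (p : (spec K (A ⧸ I)).Points) (a : A),
      (specPoints K A).symm (mapPoints (specMap (Ideal.Quotient.mkₐ K I)) p) a =
        (specPoints K (A ⧸ I)).symm p (Ideal.Quotient.mk I a) := by
    intro p a
    obtain ⟨φ, rfl⟩ := (specPoints K (A ⧸ I)).surjective p
    rw [mapPoints_specPointOf, Equiv.symm_apply_apply, Equiv.symm_apply_apply]
    rfl
  refine ⟨⟨⟨?_⟩, ?_⟩, ?_⟩
  · apply le_antisymm
    · rw [← continuous_iff_le_induced]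
      refine continuous_induced_rng.mpr (continuous_pi fun a => ?_)
      simp only [Function.comp_apply, hval]
      exact (continuous_apply (Ideal.Quotient.mk I a)).comp continuous_induced_dom
    · rw [← continuous_iff_le_induced]
      let := TopologicalSpace.induced (mapPoints (specMap (Ideal.Quotient.mkₐ K I)))
        (pointwiseTopology K A)
      refine continuous_pi fun b => ?_
      obtain ⟨a, rfl⟩ := Ideal.Quotient.mk_surjective b
      simp only [← hval]
      exact (hev a).comp continuous_induced_dom
  · intro p q h
    apply (specPoints K (A ⧸ I)).symm.injective
    ext b
    obtain ⟨a, rfl⟩ := Ideal.Quotient.mk_surjective b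
    rw [← hval, ← hval, h]
  · have : Set.range (mapPoints (specMap (Ideal.Quotient.mkₐ K I))) =
        ⋂ a ∈ I, {p : (spec K A).Points | (specPoints K A).symm p a = 0} := by
      ext p
      simp only [Set.mem_iInter, Set.mem_ofPred_eq]
      constructor
      · rintro ⟨q, rfl⟩ a ha
        rw [hval, Ideal.Quotient.eq_zero_iff_mem.mpr ha, map_zero]
      · intro h
        refine ⟨specPoints K (A ⧸ I) (Ideal.Quotient.liftₐ I ((specPoints K A).symm p) h), ?_⟩
        apply (specPoints K A).symm.injective
        ext a
        rw [hval, Equiv.symm_apply_apply]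
        rfl
    rw [this]
    exact isClosed_biInter fun a _ => isClosed_singleton.preimage (hev a)

/-- Pointwise convergence on polynomials amounts to convergence of the coordinates. -/
theorem induced_eval_eq_induced [IsTopologicalRing K] {n : ℕ} {P : Type w}
    (e₁ : P → MvPolynomial (Fin n) K → K) (e₂ : P → Fin n → K)
    (h : ∀ p q, e₁ p q = MvPolynomial.eval (e₂ p) q) :
    TopologicalSpace.induced e₁ Pi.topologicalSpace =
      TopologicalSpace.induced e₂ Pi.topologicalSpace := by
  apply le_antisymm
  · let := TopologicalSpace.induced e₁ Pi.topologicalSpace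
    rw [← continuous_iff_le_induced]
    refine continuous_pi fun i => ?_
    have h2 : ∀ p, e₂ p i = e₁ p (MvPolynomial.X i) := fun p => by rw [h, MvPolynomial.eval_X]
    simp only [h2]
    exact (continuous_apply (MvPolynomial.X i)).comp continuous_induced_dom
  · let := TopologicalSpace.induced e₂ Pi.topologicalSpace
    rw [← continuous_iff_le_induced]
    refine continuous_pi fun q => ?_
    simp only [h]
    exact (MvPolynomial.continuous_eval q).comp continuous_induced_dom

/-- For a t-Henselian topology on a field that is not separably closed, the étale-open system of
topologies is induced by it. -/
theorem IsTHenselian.etaleOpen_isInducedBy (hK : IsTHenselian K) (hsep : ¬ IsSepClosed K) :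
    (etaleOpen K).IsInducedBy ‹_› where
  isSystemOfTopologies :=
    { continuous := continuous_mapPoints_etaleOpen
      isOpenEmbedding := isOpenEmbedding_mapPoints_etaleOpen
      isClosedEmbedding := isClosedEmbedding_mapPoints_etaleOpen fun A _ _ _ I => by
        have := hK.isVTopology.isFieldTopology.t2Space
        rw [hK.etaleOpen_spec_eq hsep, hK.etaleOpen_spec_eq hsep]
        exact isClosedEmbedding_pointwiseTopology A I }
  affineSpace_eq n := by
    have := hK.isVTopology.isTopologicalRing
    have h : etaleOpen K (affineSpace K n) = pointwiseTopology K (MvPolynomial (Fin n) K) :=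
      hK.etaleOpen_spec_eq hsep _
    have hcoord : ∀ (p : (affineSpace K n).Points) (q : MvPolynomial (Fin n) K),
        (specPoints K (MvPolynomial (Fin n) K)).symm p q =
          MvPolynomial.eval (affineSpacePoints K n p) q := by
      intro p q
      obtain ⟨a, rfl⟩ := (affineSpacePoints K n).symm.surjective p
      rw [Equiv.apply_symm_apply]
      have h1 : (affineSpacePoints K n).symm a =
          specPoints K (MvPolynomial (Fin n) K) (MvPolynomial.aeval a) := rfl
      rw [h1, Equiv.symm_apply_apply]
      rfl
    exact h.trans (induced_eval_eq_induced _ _ hcoord)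

end Comparison

/-! ### Henselian valuations -/

section Valuations

open Polynomial IsLocalRing

variable {K : Type u} [Field K]

/-- Every radius in the value group is the value of an element. With elements as radii, balls are
rescaled by multiplication in `K`. -/
theorem Valued.mem_nhds_zero_iff_exists_lt {Γ₀ : Type v} [LinearOrderedCommGroupWithZero Γ₀]
    [hv : Valued K Γ₀] {s : Set K} :
    s ∈ 𝓝 (0 : K) ↔ ∃ g : K, g ≠ 0 ∧ {x | hv.v x < hv.v g} ⊆ s := by
  rw [Valued.mem_nhds_zero]
  constructor
  · rintro ⟨γ, hγ⟩
    obtain ⟨g, hg⟩ := MonoidWithZeroHom.ValueGroup₀.restrict₀_surjective (.ofClass hv.v) γ.1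
    have hg : hv.v.restrict g = γ.1 := hg
    refine ⟨g, ?_, ?_⟩
    · rintro rfl
      rw [map_zero] at hg
      exact γ.ne_zero hg.symm
    · rw [← hg] at hγ
      simpa only [Valuation.restrict_lt_iff] using hγ
  · rintro ⟨g, hg, hs⟩
    refine ⟨Units.mk0 (hv.v.restrict g) (by simpa using hg), ?_⟩
    simpa only [Units.val_mk0, Valuation.restrict_lt_iff] using hs

theorem Valued.isVTopology {Γ₀ : Type v} [LinearOrderedCommGroupWithZero Γ₀] [hv : Valued K Γ₀]
    (hn : hv.v.IsNontrivial) : IsVTopology K where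
  isFieldTopology := ⟨inferInstance, inferInstance⟩
  not_discrete := by
    intro h
    obtain ⟨g, hg, hs⟩ := Valued.mem_nhds_zero_iff_exists_lt.mp
      ((isOpen_discrete ({0} : Set K)).mem_nhds rfl)
    obtain ⟨x, hx0, hx1⟩ := hn.exists_val_nontrivial
    have hx : x ≠ 0 := (Valuation.ne_zero_iff _).mp hx0
    have hg' : 0 < hv.v g := zero_lt_iff.mpr ((Valuation.ne_zero_iff _).mpr hg)
    rcases lt_or_gt_of_ne hx1 with h1 | h1
    · refine mul_ne_zero hx hg (hs ?_)
      change hv.v (x * g) < hv.v g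
      rw [map_mul]
      exact mul_lt_of_lt_one_left hg' h1
    · refine mul_ne_zero (inv_ne_zero hx) hg (hs ?_)
      change hv.v (x⁻¹ * g) < hv.v g
      rw [map_mul, map_inv₀]
      exact mul_lt_of_lt_one_left hg' (inv_lt_one_of_one_lt₀ h1)
  bounded_inv U hU T hT hT0 := by
    obtain ⟨g, hg, hgU⟩ := Valued.mem_nhds_zero_iff_exists_lt.mp hU
    obtain ⟨d, hd, hdT⟩ := Valued.mem_nhds_zero_iff_exists_lt.mp (hT.mem_nhds hT0)
    obtain ⟨x, hx0, hx1⟩ : ∃ x, x ≠ 0 ∧ hv.v x < 1 := by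
      obtain ⟨x, hx0, hx1⟩ := hn.exists_val_nontrivial
      have hx : x ≠ 0 := (Valuation.ne_zero_iff _).mp hx0
      rcases lt_or_gt_of_ne hx1 with h1 | h1
      · exact ⟨x, hx, h1⟩
      · exact ⟨x⁻¹, inv_ne_zero hx, by rw [map_inv₀]; exact inv_lt_one_of_one_lt₀ h1⟩
    -- The factor `d * g` alone gives only `≤`; the extra `x` with value below `1` makes the
    -- inequality strict.
    refine ⟨x * d * g, mul_ne_zero (mul_ne_zero hx0 hd) hg, ?_⟩
    rintro _ ⟨y, hy, rfl⟩
    have hgy : hv.v g ≤ hv.v y := not_lt.mp fun h => hy (hgU h)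
    have hg' : 0 < hv.v g := zero_lt_iff.mpr ((Valuation.ne_zero_iff _).mpr hg)
    have hd' : 0 < hv.v d := zero_lt_iff.mpr ((Valuation.ne_zero_iff _).mpr hd)
    apply hdT
    change hv.v (x * d * g * y⁻¹) < hv.v d
    have h1 : hv.v g * (hv.v y)⁻¹ ≤ 1 := by
      rw [← div_eq_mul_inv]
      exact div_le_one_of_le₀ hgy zero_le
    calc hv.v (x * d * g * y⁻¹) = hv.v x * hv.v d * (hv.v g * (hv.v y)⁻¹) := by
          simp only [map_mul, map_inv₀, mul_assoc]
      _ ≤ hv.v x * hv.v d := mul_le_of_le_one_right' h1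
      _ < hv.v d := mul_lt_of_lt_one_left hd' hx1

/-- Over a Henselian local ring, small perturbations of `x ^ n * (x + 1)` have a root. -/
theorem HenselianLocalRing.exists_root_of_mem_maximalIdeal {R : Type*} [CommRing R]
    [HenselianLocalRing R] (n : ℕ) (α : Fin (n + 1) → R) (hα : ∀ i, α i ∈ maximalIdeal R) :
    ∃ x : R, x ^ (n + 2) + x ^ (n + 1) + ∑ i : Fin (n + 1), α i * x ^ (i : ℕ) = 0 := by
  let q : R[X] := ∑ i : Fin (n + 1), C (α i) * X ^ (i : ℕ)
  let f : R[X] := X ^ (n + 2) + (X ^ (n + 1) + q)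
  have hf : f.Monic := by
    nontriviality R
    refine monic_X_pow_add ((degree_add_le _ _).trans_lt (max_lt ?_ ?_))
    · rw [degree_X_pow]
      exact_mod_cast Nat.lt_succ_self _
    · refine (degree_sum_fin_lt α).trans ?_
      exact_mod_cast Nat.lt_succ_self _
  -- Modulo the maximal ideal `f` is `X ^ (n + 1) * (X + 1)`, with simple root `-1`.
  have h0 : f.eval (-1) ∈ maximalIdeal R := by
    have : f.eval (-1) = ∑ i : Fin (n + 1), α i * (-1) ^ (i : ℕ) := by
      simp [f, q, eval_finsetSum, pow_succ]
    rw [this]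
    exact sum_mem fun i _ => Ideal.mul_mem_right _ _ (hα i)
  have h1 : IsUnit (f.derivative.eval (-1)) := by
    have hq : q.derivative.eval (-1) ∈ maximalIdeal R := by
      simp only [q, derivative_sum, derivative_C_mul, eval_finsetSum, eval_mul, eval_C]
      exact sum_mem fun i _ => Ideal.mul_mem_right _ _ (hα i)
    have : f.derivative.eval (-1) = (-1) ^ (n + 1) + q.derivative.eval (-1) := by
      simp [f, pow_succ]
      ring
    rw [this]
    by_contra h
    have h2 := sub_mem ((mem_maximalIdeal _).mpr h) hq
    rw [add_sub_cancel_right] at h2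
    exact (mem_maximalIdeal _).mp h2 (isUnit_one.neg.pow _)
  obtain ⟨x, hx, -⟩ := HenselianLocalRing.is_henselian f hf _ h0 h1
  refine ⟨x, ?_⟩
  have := hx.eq_zero
  simp only [f, q, eval_add, eval_pow, eval_X, eval_finsetSum, eval_mul, eval_C] at this
  rw [add_assoc]
  exact this

/-- The topology of a non-trivial Henselian valuation is t-Henselian. -/
theorem Valued.isTHenselian {Γ₀ : Type v} [LinearOrderedCommGroupWithZero Γ₀] [hv : Valued K Γ₀]
    (hn : hv.v.IsNontrivial) (hh : HenselianLocalRing hv.v.valuationSubring) :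
    IsTHenselian K where
  isVTopology := Valued.isVTopology hn
  exists_root n := by
    have hU : {x : K | hv.v x < 1} ∈ 𝓝 (0 : K) :=
      Valued.mem_nhds_zero_iff_exists_lt.mpr ⟨1, one_ne_zero, by rw [map_one]⟩
    refine ⟨interior {x : K | hv.v x < 1}, isOpen_interior, mem_interior_iff_mem_nhds.mpr hU,
      fun α hα => ?_⟩
    have hα' : ∀ i, hv.v (α i) < 1 := fun i =>
      (interior_subset : _ ⊆ {x : K | hv.v x < 1}) (hα i)
    obtain ⟨x, hx⟩ := HenselianLocalRing.exists_root_of_mem_maximalIdeal n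
      (fun i => (⟨α i, (hv.v.mem_valuationSubring_iff _).mpr (hα' i).le⟩ : hv.v.valuationSubring))
      (fun i => by
        rw [mem_maximalIdeal, mem_nonunits_iff, isUnit_iff_exists_inv]
        rintro ⟨b, hb⟩
        have hb' : α i * (b : K) = 1 := congrArg Subtype.val hb
        have hb1 : hv.v b ≤ 1 := (hv.v.mem_valuationSubring_iff _).mp b.2
        have h1 := congrArg hv.v hb'
        rw [map_mul, map_one] at h1
        exact (mul_lt_one_of_lt_of_le (hα' i) hb1).ne h1)
    refine ⟨x, ?_⟩
    have h := congrArg (fun t : hv.v.valuationSubring => (t : K)) hx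
    simpa using h

end Valuations

/-! ### Real closed fields -/

namespace IsRealClosed

open Polynomial Module IntermediateField

variable {K : Type u} [Field K]

/-- A real closed field has no proper finite separable extension of odd degree. -/
theorem finrank_eq_one_of_odd [IsRealClosed K] (F : Type*) [Field F] [Algebra K F]
    [FiniteDimensional K F] [Algebra.IsSeparable K F] (h : Odd (finrank K F)) :
    finrank K F = 1 := by
  obtain ⟨α, hα⟩ := Field.exists_primitive_element K F
  have hint : IsIntegral K α := .of_finite K α
  have hdeg : (minpoly K α).natDegree = finrank K F := by
    rw [← adjoin.finrank hint, hα, finrank_top']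
  obtain ⟨x, hx⟩ := exists_isRoot_of_odd_natDegree (f := minpoly K α) (hdeg ▸ h)
  rw [← hdeg]
  exact natDegree_eq_of_degree_eq_some
    (degree_eq_one_of_irreducible_of_root (minpoly.irreducible hint) hx)

/-- A finite Galois extension of a real closed field has `2`-power degree. -/
theorem exists_finrank_eq_two_pow [IsRealClosed K] (L : Type*) [Field L] [Algebra K L]
    [FiniteDimensional K L] [IsGalois K L] : ∃ k, finrank K L = 2 ^ k := by
  have : Fact (Nat.Prime 2) := ⟨Nat.prime_two⟩
  obtain ⟨P⟩ : Nonempty (Sylow 2 (L ≃ₐ[K] L)) := inferInstance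
  have h1 : finrank (fixedField (P : Subgroup (L ≃ₐ[K] L))) L = Nat.card P :=
    finrank_fixedField_eq_card _
  have h2 := finrank_mul_finrank K (fixedField (P : Subgroup (L ≃ₐ[K] L))) L
  have h3 : Nat.card P * (P : Subgroup (L ≃ₐ[K] L)).index = finrank K L := by
    rw [← IsGalois.card_aut_eq_finrank K L]
    exact Subgroup.card_mul_index _
  have hpos : 0 < Nat.card P := Nat.card_pos
  have h4 : finrank K (fixedField (P : Subgroup (L ≃ₐ[K] L))) =
      (P : Subgroup (L ≃ₐ[K] L)).index := by
    rw [h1, ← h3, mul_comm] at h2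
    exact Nat.eq_of_mul_eq_mul_left hpos h2
  -- The fixed field of a Sylow 2-subgroup has odd degree over `K`, hence degree `1`, so the Galois
  -- group is a 2-group.
  have hodd : Odd (finrank K (fixedField (P : Subgroup (L ≃ₐ[K] L)))) := by
    rw [h4, ← Nat.not_even_iff_odd, even_iff_two_dvd]
    exact P.not_dvd_index
  have h5 := finrank_eq_one_of_odd _ hodd
  obtain ⟨k, hk⟩ := IsPGroup.iff_card.mp P.isPGroup'
  refine ⟨k, ?_⟩
  rw [← h3, ← h4, h5, mul_one]
  exact hk

variable [LinearOrder K] [IsStrictOrderedRing K]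

/-- In a quadratic extension of a real closed field generated by a square root of `-1`,
all elements are squares. -/
theorem isSquare_of_finrank_eq_two [IsRealClosed K] {C : Type*} [Field C] [Algebra K C]
    (hC : finrank K C = 2) {i : C} (hi : i * i = -1) (z : C) : IsSquare z := by
  have hiK : ∀ a : K, algebraMap K C a ≠ i := by
    rintro a rfl
    rw [← map_mul, ← map_one (algebraMap K C), ← map_neg] at hi
    have := (algebraMap K C).injective hi
    nlinarith [mul_self_nonneg a]
  have hli : LinearIndependent K ![1, i] := by
    refine LinearIndependent.pair_iff.mpr fun s t hst => ?_
    have ht : t = 0 := by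
      by_contra ht
      refine hiK (-s / t) ?_
      have ht' : algebraMap K C t ≠ 0 := by simpa using ht
      rw [Algebra.smul_def, Algebra.smul_def, mul_one] at hst
      rw [map_div₀, map_neg, div_eq_iff ht']
      linear_combination -hst
    rw [ht, zero_smul, add_zero, Algebra.smul_def, mul_one] at hst
    exact ⟨by simpa using hst, ht⟩
  have hspan := hli.span_eq_top_of_card_eq_finrank (by simp [hC])
  have hz : z ∈ Submodule.span K (Set.range ![1, i]) := by rw [hspan]; trivial
  rw [Matrix.range_cons, Matrix.range_cons, Matrix.range_empty, Set.union_empty,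
    Set.singleton_union, Submodule.mem_span_pair] at hz
  obtain ⟨a, b, rfl⟩ := hz
  simp only [Algebra.smul_def, mul_one]
  by_cases hb : b = 0
  · subst hb
    rcases isSquare_or_isSquare_neg a with ⟨r, hr⟩ | ⟨r, hr⟩
    · exact ⟨algebraMap K C r, by rw [← map_mul, ← hr]; simp⟩
    · refine ⟨algebraMap K C r * i, ?_⟩
      have := congrArg (algebraMap K C) hr
      rw [map_neg, map_mul] at this
      rw [map_zero]
      linear_combination -this - (algebraMap K C r) ^ 2 * hi
  · have hb2 : 0 < b * b := mul_self_pos.mpr hb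
    obtain ⟨n, hn0, hn⟩ : ∃ n : K, 0 ≤ n ∧ a * a + b * b = n * n := by
      obtain ⟨n, hn⟩ := IsSquare.of_nonneg (add_nonneg (mul_self_nonneg a) hb2.le)
      exact ⟨|n|, abs_nonneg n, by rw [hn, abs_mul_abs_self]⟩
    -- Here `n` is the absolute value of `a + b * i`, and the root is `s + b / (2 * s) * i` with `s
    -- ^ 2 = (n + a) / 2`. Positivity uses `b ≠ 0`.
    have hna : 0 < n + a := by nlinarith
    obtain ⟨s, hs⟩ := IsSquare.of_nonneg (half_pos hna).le
    have hs0 : s ≠ 0 := by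
      rintro rfl
      linarith
    have h1 : a = s * s - b / (2 * s) * (b / (2 * s)) := by
      field_simp
      nlinarith
    have h2 : b = 2 * s * (b / (2 * s)) := by field_simp
    refine ⟨algebraMap K C s + algebraMap K C (b / (2 * s)) * i, ?_⟩
    generalize b / (2 * s) = t at h1 h2
    rw [h1, h2]
    simp only [map_sub, map_mul, map_ofNat]
    linear_combination -(algebraMap K C t) ^ 2 * hi

/-- A field in which all elements are squares has no separable quadratic extension. -/
theorem _root_.Module.finrank_ne_two_of_forall_isSquare {C : Type*} [Field C] [NeZero (2 : C)]
    (h : ∀ z : C, IsSquare z) (F : Type*) [Field F] [Algebra C F] [FiniteDimensional C F]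
    [Algebra.IsSeparable C F] : finrank C F ≠ 2 := by
  intro hF
  obtain ⟨α, hα⟩ := Field.exists_primitive_element C F
  have hint : IsIntegral C α := .of_finite C α
  have hdeg : (minpoly C α).natDegree = 2 := by
    rw [← adjoin.finrank hint, hα, finrank_top', hF]
  obtain ⟨x, hx⟩ := exists_quadratic_eq_zero (one_ne_zero (α := C))
    (h (discrim 1 ((minpoly C α).coeff 1) ((minpoly C α).coeff 0)))
  have hroot : (minpoly C α).IsRoot x := by
    have hlead : (minpoly C α).coeff 2 = 1 := by
      rw [← hdeg]
      exact minpoly.monic hint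
    rw [IsRoot, eval_eq_sum_range, hdeg, Finset.sum_range_succ, Finset.sum_range_succ,
      Finset.sum_range_succ, Finset.sum_range_zero, hlead]
    linear_combination hx
  have h1 : (minpoly C α).natDegree = 1 := natDegree_eq_of_degree_eq_some
    (degree_eq_one_of_irreducible_of_root (minpoly.irreducible hint) hroot)
  omega

/-- A finite Galois extension of a real closed field that contains a square root of `-1` is
quadratic. -/
theorem finrank_eq_two [IsRealClosed K] {L : Type*} [Field L] [Algebra K L]
    [FiniteDimensional K L] [IsGalois K L] {i : L} (hi : i * i = -1) : finrank K L = 2 := by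
  have : Fact (Nat.Prime 2) := ⟨Nat.prime_two⟩
  have : CharZero L := charZero_of_injective_algebraMap (algebraMap K L).injective
  have hint : IsIntegral K i := .of_finite K i
  have hmin : minpoly K i = X ^ 2 + C 1 := by
    refine (minpoly.eq_of_irreducible_of_monic ?_ ?_ (monic_X_pow_add_C 1 two_ne_zero)).symm
    · refine (irreducible_iff_roots_eq_zero_of_degree_le_three ?_ ?_).mpr ?_
      · rw [natDegree_X_pow_add_C]
      · rw [natDegree_X_pow_add_C]
        norm_num
      · refine Multiset.eq_zero_of_forall_notMem fun x hx => ?_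
        have := isRoot_of_mem_roots hx
        simp only [IsRoot, eval_add, eval_pow, eval_X, eval_C] at this
        nlinarith [sq_nonneg x]
    · simp [sq, hi]
  have hC : finrank K K⟮i⟯ = 2 := by
    rw [adjoin.finrank hint, hmin, natDegree_X_pow_add_C]
  obtain ⟨k, hk⟩ := exists_finrank_eq_two_pow (K := K) L
  have hmul := finrank_mul_finrank K K⟮i⟯ L
  rw [hC, hk] at hmul
  rcases k with _ | _ | k
  · omega
  · exact hk
  · exfalso
    have hCL : finrank K⟮i⟯ L = 2 ^ (k + 1) := by
      rw [pow_succ] at hmul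
      omega
    have hcard : Nat.card (L ≃ₐ[K⟮i⟯] L) = 2 ^ (k + 1) := by
      rw [IsGalois.card_aut_eq_finrank, hCL]
    -- An index-2 subgroup gives a quadratic extension of `K⟮i⟯`, which is impossible since every
    -- element there is a square.
    obtain ⟨N, hN⟩ := Sylow.exists_subgroup_card_pow_prime (G := L ≃ₐ[K⟮i⟯] L) 2 (n := k)
      (hcard ▸ pow_dvd_pow 2 (Nat.le_succ k))
    have h1 : finrank (fixedField N) L = 2 ^ k := (finrank_fixedField_eq_card N).trans hN
    have h2 := finrank_mul_finrank K⟮i⟯ (fixedField N) L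
    rw [h1, hCL, pow_succ, mul_comm] at h2
    have h3 := Nat.eq_of_mul_eq_mul_left (pow_pos two_pos k) h2
    have hsq : ∀ z : K⟮i⟯, IsSquare z :=
      isSquare_of_finrank_eq_two hC (i := AdjoinSimple.gen K i)
        (Subtype.ext (by simpa using hi))
    exact finrank_ne_two_of_forall_isSquare hsq _ h3

/-- Irreducible polynomials over a real closed field have degree at most `2`. -/
theorem natDegree_le_two_of_irreducible [IsRealClosed K] {q : K[X]} (hq : Irreducible q) :
    q.natDegree ≤ 2 := by
  have hne : q * (X ^ 2 + C 1) ≠ 0 :=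
    mul_ne_zero hq.ne_zero (monic_X_pow_add_C 1 two_ne_zero).ne_zero
  -- The factor `X ^ 2 + 1` puts a square root of `-1` into `L`, so `L` is quadratic over `K` and
  -- contains a root of `q`.
  let L := SplittingField (q * (X ^ 2 + C 1))
  have : Normal K L := Normal.of_isSplittingField (q * (X ^ 2 + C 1))
  have : IsGalois K L := ⟨⟩
  have hsplit : ((q * (X ^ 2 + C 1)).map (algebraMap K L)).Splits := SplittingField.splits _
  have hne' : (q * (X ^ 2 + C 1)).map (algebraMap K L) ≠ 0 := Polynomial.map_ne_zero hne
  obtain ⟨x, hx⟩ := (hsplit.of_dvd hne' (Polynomial.map_dvd _ (dvd_mul_right q _))).exists_eval_eq_zero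
    (by rw [degree_map]; exact hq.degree_pos.ne')
  obtain ⟨i, hi⟩ := (hsplit.of_dvd hne' (Polynomial.map_dvd _ (dvd_mul_left _ q))).exists_eval_eq_zero
    (by rw [degree_map, degree_X_pow_add_C two_pos]; simp)
  have hi' : i * i = -1 := by
    simp at hi
    linear_combination hi
  rw [← finrank_eq_two (K := K) hi']
  rw [eval_map_algebraMap] at hx
  have h1 := minpoly.natDegree_le (A := K) x
  rwa [← minpoly.eq_of_irreducible hq hx, natDegree_mul_C] at h1
  exact inv_ne_zero (leadingCoeff_ne_zero.mpr hq.ne_zero)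

/-- A monic polynomial without roots over a real closed field is positive. -/
theorem eval_pos_of_forall_not_isRoot [IsRealClosed K] (p : K[X]) (hp : p.Monic)
    (hroot : ∀ x, ¬ p.IsRoot x) (x : K) : 0 < p.eval x := by
  induction hn : p.natDegree using Nat.strong_induction_on generalizing p with
  | _ n ih =>
    by_cases hu : IsUnit p
    · rw [hp.eq_one_of_isUnit hu, eval_one]
      exact one_pos
    · obtain ⟨q, hq, hqi, r, rfl⟩ := exists_monic_irreducible_factor p hu
      have hr : r.Monic := hq.of_mul_monic_left hp
      rw [eval_mul]
      have hqdeg : 0 < q.natDegree := hqi.natDegree_pos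
      have hqroot : ∀ y, ¬ q.IsRoot y := fun y hy => hroot y (by
        rw [IsRoot, eval_mul, hy.eq_zero, zero_mul])
      refine mul_pos ?_ (ih r.natDegree ?_ r hr (fun y hy => hroot y (by
        rw [IsRoot, eval_mul, hy.eq_zero, mul_zero])) rfl)
      · have hle := natDegree_le_two_of_irreducible hqi
        have h2 : q.natDegree = 2 := by
          by_contra h
          have h1 : q.natDegree = 1 := by omega
          rw [hq.eq_X_add_C h1] at hqroot
          exact hqroot (-q.coeff 0) (by simp)
        have heval : ∀ y, q.eval y = y * y + q.coeff 1 * y + q.coeff 0 := by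
          intro y
          have hlead : q.coeff 2 = 1 := by
            rw [← h2]
            exact hq
          rw [eval_eq_sum_range, h2, Finset.sum_range_succ, Finset.sum_range_succ,
            Finset.sum_range_succ, Finset.sum_range_zero, hlead]
          ring
        by_contra hneg
        rw [heval] at hneg
        -- The discriminant equals `(2 * x + q.coeff 1) ^ 2 - 4 * q.eval x`, so a nonpositive value
        -- of `q` would force a root.
        have hd : 0 ≤ discrim 1 (q.coeff 1) (q.coeff 0) := by
          rw [discrim]
          nlinarith [sq_nonneg (2 * x + q.coeff 1)]
        obtain ⟨y, hy⟩ := exists_quadratic_eq_zero (one_ne_zero (α := K)) (IsSquare.of_nonneg hd)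
        refine hqroot y ?_
        rw [IsRoot, heval]
        linear_combination hy
      · rw [← hn, hq.natDegree_mul hr]
        omega

theorem not_isSepClosed [IsRealClosed K] : ¬ IsSepClosed K := by
  intro h
  obtain ⟨x, hx⟩ := IsSepClosed.exists_eq_mul_self (-1 : K)
  nlinarith [mul_self_nonneg x]

end IsRealClosed

/-! ### The order topology of a real closed field -/

section OrderTopology

variable {K : Type u} [Field K] [LinearOrder K] [IsStrictOrderedRing K] [TopologicalSpace K]
  [OrderTopology K]

theorem isVTopology_of_orderTopology : IsVTopology K where
  isFieldTopology := ⟨inferInstance, inferInstance⟩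
  not_discrete h := by
    have h0 : ({0} : Set K) ∈ 𝓝 (0 : K) := (isOpen_discrete _).mem_nhds rfl
    obtain ⟨ε, hε, hU⟩ := (nhds_basis_abs_sub_lt (0 : K)).mem_iff.mp h0
    have : ε / 2 = 0 := hU (by
      change |ε / 2 - 0| < ε
      rw [sub_zero, abs_of_pos (half_pos hε)]
      exact half_lt_self hε)
    linarith
  bounded_inv U hU T hT hT0 := by
    obtain ⟨ε, hε, hεU⟩ := (nhds_basis_abs_sub_lt (0 : K)).mem_iff.mp hU
    obtain ⟨δ, hδ, hδT⟩ := (nhds_basis_abs_sub_lt (0 : K)).mem_iff.mp (hT.mem_nhds hT0)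
    refine ⟨δ / 2 * ε, by positivity, ?_⟩
    rintro _ ⟨y, hy, rfl⟩
    have hεy : ε ≤ |y| := by
      by_contra h
      exact hy (hεU (by simpa using h))
    apply hδT
    change |δ / 2 * ε * y⁻¹ - 0| < δ
    have hy0 : 0 < |y| := hε.trans_le hεy
    rw [sub_zero, abs_mul, abs_inv, abs_of_pos (by positivity : 0 < δ / 2 * ε), ← div_eq_mul_inv,
      div_lt_iff₀ hy0]
    nlinarith

open Polynomial in
/-- The order topology of a real closed field is t-Henselian. -/
theorem IsRealClosed.isTHenselian [IsRealClosed K] : IsTHenselian K where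
  isVTopology := isVTopology_of_orderTopology
  exists_root n := by
    -- For even `n` the two leading terms at `-1 / 2` add up to `-(1 / 2) ^ (n + 2)`, and the other
    -- `n + 1` terms contribute at most `(n + 1) * ε`. The value is thus nonpositive, which
    -- contradicts positivity of a monic polynomial without roots. For odd `n` the degree is odd and
    -- any `ε` works.
    let ε : K := (1 / 2) ^ (n + 2) / (n + 1)
    have hε : 0 < ε := by positivity
    refine ⟨Set.Ioo (-ε) ε, isOpen_Ioo, ⟨neg_lt_zero.mpr hε, hε⟩, fun α hα => ?_⟩
    let f : K[X] := X ^ (n + 2) + (X ^ (n + 1) + ∑ i : Fin (n + 1), C (α i) * X ^ (i : ℕ))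
    have hdeg : (X ^ (n + 1) + ∑ i : Fin (n + 1), C (α i) * X ^ (i : ℕ)).degree < (n + 2 : ℕ) := by
      refine (degree_add_le _ _).trans_lt (max_lt ?_ ?_)
      · rw [degree_X_pow]
        exact_mod_cast Nat.lt_succ_self _
      · refine (degree_sum_fin_lt α).trans ?_
        exact_mod_cast Nat.lt_succ_self _
    have hf : f.Monic := monic_X_pow_add hdeg
    have heval : ∀ x, f.eval x =
        x ^ (n + 2) + x ^ (n + 1) + ∑ i : Fin (n + 1), α i * x ^ (i : ℕ) := by
      intro x
      simp [f, eval_finsetSum, add_assoc]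
    simp_rw [← heval]
    rcases Nat.even_or_odd n with he | ho
    · by_contra! hroot
      have hpos := IsRealClosed.eval_pos_of_forall_not_isRoot f hf hroot (-(1 / 2))
      rw [heval] at hpos
      have hodd : Odd (n + 1) := he.add_one
      have hodd2 : Even (n + 2) := by
        rw [Nat.even_add]
        simp [he]
      rw [hodd.neg_pow, hodd2.neg_pow] at hpos
      have hsum : ∑ i : Fin (n + 1), α i * (-(1 / 2)) ^ (i : ℕ) ≤ ∑ _i : Fin (n + 1), ε := by
        refine Finset.sum_le_sum fun i _ => (le_abs_self _).trans ?_
        rw [abs_mul, abs_pow, abs_neg, abs_of_pos (by norm_num : (0 : K) < 1 / 2)]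
        have h1 : |α i| ≤ ε := (abs_lt.mpr (hα i)).le
        have h2 : (1 / 2 : K) ^ (i : ℕ) ≤ 1 := pow_le_one₀ (by norm_num) (by norm_num)
        calc |α i| * (1 / 2) ^ (i : ℕ) ≤ |α i| * 1 := by gcongr
          _ ≤ ε := by rwa [mul_one]
      have hsum' : ∑ _i : Fin (n + 1), ε = (1 / 2) ^ (n + 2) := by
        rw [Finset.sum_const, Finset.card_univ, Fintype.card_fin, nsmul_eq_mul]
        push_cast
        simp only [ε]
        field_simp
      rw [hsum'] at hsum
      have : (1 / 2 : K) ^ (n + 2) = 1 / 2 * (1 / 2) ^ (n + 1) := pow_succ' _ _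
      linarith
    · refine IsRealClosed.exists_isRoot_of_odd_natDegree (f := f) ?_
      have : f.natDegree = n + 2 := by
        rw [natDegree_add_eq_left_of_degree_lt, natDegree_X_pow]
        rwa [degree_X_pow]
      rw [this, Nat.odd_add]
      simp [ho]

end OrderTopology

/-! ### The three statements of the theorem -/

theorem mainTheorem3 (K : Type u) [Field K] :
    (∀ τ : TopologicalSpace K, @IsTHenselian K _ τ → ¬ IsSepClosed K →
      (etaleOpen K).IsInducedBy τ) ∧
    (∀ [LinearOrder K] [IsStrictOrderedRing K], IsRealClosed K →
      @IsTHenselian K _ (Preorder.topology K) ∧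
        (etaleOpen K).IsInducedBy (Preorder.topology K)) ∧
    (∀ (Γ₀ : Type v) [LinearOrderedCommGroupWithZero Γ₀] (v : Valuation K Γ₀),
      v.IsNontrivial → HenselianLocalRing v.valuationSubring →
      @IsTHenselian K _ (Valued.mk' v).toTopologicalSpace ∧
        (¬ IsSepClosed K → (etaleOpen K).IsInducedBy (Valued.mk' v).toTopologicalSpace)) := by
  refine ⟨fun τ hτ hsep => hτ.etaleOpen_isInducedBy hsep, fun hK => ?_, fun Γ₀ _ v hn hh => ?_⟩
  · let := Preorder.topology K
    have : OrderTopology K := ⟨rfl⟩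
    have h : IsTHenselian K := IsRealClosed.isTHenselian
    exact ⟨h, h.etaleOpen_isInducedBy IsRealClosed.not_isSepClosed⟩
  · let := Valued.mk' v
    have h : IsTHenselian K := Valued.isTHenselian hn hh
    exact ⟨h, h.etaleOpen_isInducedBy⟩
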